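/- **Proposition 5.8.** Let $M$ be a closed smooth manifold, $f\colon M\to M$ a $C^1$ map, and $n=kl$ with integers $k,l\ge 1$. Let $\Phi_n(f)\colon M^n\to M^n$, $(x_1,\dots,x_n)\mapsto(f(x_n),f(x_1),\dots,f(x_{n-1}))$, be the Fuller map. It is equivariant for the action of $\mathbb{Z}_n=\langle g\rangle$ on $M^n$ by $g\cdot(x_1,\dots,x_n)=(x_n,x_1,\dots,x_{n-1})$. Let $\mathbb{Z}_k=\langle g^l\rangle$ be the subgroup of order $k$, and let $\Phi_n^k(f)$ be the restriction of $\Phi_n(f)$ to the fixed point set $(M^n)^{\mathbb{Z}_k}$. The map $M^l\to (M^n)^{\mathbb{Z}_k}$ that repeats an $l$-tuple $k$ times is a homeomorphism, through which $(M^n)^{\mathbb{Z}_k}$ is regarded as a manifold. For an isolated fixed point $p$ of a self-map $F$ of a $d$-manifold, the fixed point index $i(F,p)$ is the integer such that, in a chart at $p$ and for an open neighbourhood $V$ of $p$ in it that contains no other fixed point and on which $F$ is defined, continuous and takes values in the chart, the homomorphism $(\mathrm{id}-F)_*\colon H_d(V,V\setminus\{p\};\mathbb{Z})\to H_d(\mathbb{R}^d,\mathbb{R}^d\setminus\{0\};\mathbb{Z})$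 sends the fundamental class at $p$ to $i(F,p)$ times the fundamental class at $0$. The fixed point class $[p]$ of $F$ consists of the fixed points $q$ that can be joined to $p$ by a path $\gamma$ which is homotopic to $F\circ\gamma$ relative to its endpoints; if $[p]$ is a finite set of isolated fixed points, its index is $i(F,[p])=\sum_{q\in[p]}i(F,q)$. Suppose that $f^l$ has only generic fixed points, that is, $\det(I-D_xf^l)\ne 0$ for every $x\in\operatorname{Fix}(f^l)$. Let $x\in\operatorname{Fix}(f^l)$, and put $\vec{x}=(x,f(x),\dots,f^{l-1}(x))\in M^l$; the same symbol denotes the corresponding point of $(M^n)^{\mathbb{Z}_k}$. Then $x$ and $\vec x$ are isolated fixed points of the respective maps, their fixed point classes are finite sets of isolated fixed points, and $$i(\Phi_n^k(f),\vec{x})=i(\Phi_l(f),\vec{x})=i(f^l,x),$$ $$i(\Phi_n^k(f),[\vec{x}])=i(\Phi_l(f),[\vec{x}])=i(f^l,[x]).$$ -/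

import Mathlib

open scoped Manifold ContDiff

noncomputable section

namespace FixedPointIndex

/-! ### Relative singular homology with integer coefficients -/

/-- Singular `n`-simplices of `X`. -/
abbrev SingularSimplex (X : Type*) [TopologicalSpace X] (n : ℕ) : Type _ :=
  C(stdSimplex ℝ (Fin (n + 1)), X)

/-- Singular `n`-chains of `X`: the free abelian group on the singular `n`-simplices. -/
abbrev Chain (X : Type*) [TopologicalSpace X] (n : ℕ) : Type _ :=
  SingularSimplex X n →₀ ℤ

/-- The inclusion of the `i`-th face of the standard `(n+1)`-simplex. -/
def faceMap (n : ℕ) (i : Fin (n + 2)) :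
    C(stdSimplex ℝ (Fin (n + 1)), stdSimplex ℝ (Fin (n + 2))) :=
  ⟨stdSimplex.map i.succAbove, stdSimplex.continuous_map _⟩

/-- The singular boundary operator `∂ σ = ∑ i, (-1)^i σ ∘ δ_i`. -/
def boundary (X : Type*) [TopologicalSpace X] (n : ℕ) : Chain X (n + 1) →ₗ[ℤ] Chain X n :=
  ∑ i : Fin (n + 2), ((-1 : ℤ) ^ (i : ℕ)) •
    Finsupp.lmapDomain ℤ ℤ (fun σ : SingularSimplex X (n + 1) => σ.comp (faceMap n i))

/-- The chains of `X` all of whose simplices lie in `A`, i.e. the chains of the subspace `A`. -/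
def chainsIn {X : Type*} [TopologicalSpace X] (A : Set X) (n : ℕ) : Submodule ℤ (Chain X n) :=
  Finsupp.supported ℤ ℤ {σ : SingularSimplex X n | ∀ t, σ t ∈ A}

/-- Relative cycles of the pair `(X, A)`. -/
def relCycles {X : Type*} [TopologicalSpace X] (A : Set X) : (n : ℕ) → Submodule ℤ (Chain X n)
  | 0 => ⊤
  | n + 1 => (chainsIn A n).comap (boundary X n)

/-- Relative boundaries of the pair `(X, A)`. -/
def relBoundaries {X : Type*} [TopologicalSpace X] (A : Set X) (n : ℕ) :
    Submodule ℤ (Chain X n) :=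
  LinearMap.range (boundary X n) ⊔ chainsIn A n

/-- The relative singular homology group `H_n(X, A; ℤ)`. -/
abbrev RelHomology {X : Type*} [TopologicalSpace X] (A : Set X) (n : ℕ) : Type _ :=
  relCycles A n ⧸ (relBoundaries A n).comap (relCycles A n).subtype

section Map

variable {X Y : Type*} [TopologicalSpace X] [TopologicalSpace Y]

/-- The chain map induced by a continuous map. -/
def chainMap (g : C(X, Y)) (n : ℕ) : Chain X n →ₗ[ℤ] Chain Y n :=
  Finsupp.lmapDomain ℤ ℤ (fun σ : SingularSimplex X n => g.comp σ)

theorem chainMap_boundary (g : C(X, Y)) (n : ℕ) (c : Chain X (n + 1)) :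
    chainMap g n (boundary X n c) = boundary Y n (chainMap g (n + 1) c) := by
  induction c using Finsupp.induction_linear with
  | zero => simp
  | add a b ha hb => simp only [map_add, ha, hb]
  | single σ a =>
    simp only [chainMap, boundary, LinearMap.sum_apply, LinearMap.smul_apply, map_sum, map_smul,
      Finsupp.lmapDomain_apply, Finsupp.mapDomain_single, ContinuousMap.comp_assoc]

theorem chainMap_mem_chainsIn (g : C(X, Y)) {A : Set X} {B : Set Y} (h : Set.MapsTo g A B)
    (n : ℕ) {c : Chain X n} (hc : c ∈ chainsIn A n) : chainMap g n c ∈ chainsIn B n := by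
  classical
  rw [chainsIn, Finsupp.mem_supported] at hc ⊢
  intro τ hτ
  obtain ⟨σ, hσ, rfl⟩ := Finset.mem_image.1 (Finsupp.mapDomain_support hτ)
  exact fun t => h (hc hσ t)

theorem chainMap_mem_relCycles (g : C(X, Y)) {A : Set X} {B : Set Y} (h : Set.MapsTo g A B)
    (n : ℕ) {c : Chain X n} (hc : c ∈ relCycles A n) : chainMap g n c ∈ relCycles B n := by
  cases n with
  | zero => exact Submodule.mem_top
  | succ n =>
    change boundary Y n (chainMap g (n + 1) c) ∈ chainsIn B n
    rw [← chainMap_boundary]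
    exact chainMap_mem_chainsIn g h n hc

theorem chainMap_mem_relBoundaries (g : C(X, Y)) {A : Set X} {B : Set Y} (h : Set.MapsTo g A B)
    (n : ℕ) {c : Chain X n} (hc : c ∈ relBoundaries A n) :
    chainMap g n c ∈ relBoundaries B n := by
  obtain ⟨_, ⟨b, rfl⟩, a, ha, rfl⟩ := Submodule.mem_sup.1 hc
  rw [map_add, chainMap_boundary]
  exact Submodule.add_mem_sup ⟨_, rfl⟩ (chainMap_mem_chainsIn g h n ha)

/-- The map of relative cycles induced by a map of pairs. -/
def cyclesMap (g : C(X, Y)) {A : Set X} {B : Set Y} (h : Set.MapsTo g A B) (n : ℕ) :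
    relCycles A n →ₗ[ℤ] relCycles B n :=
  (chainMap g n).restrict fun _ hc => chainMap_mem_relCycles g h n hc

theorem comap_le_comap_cyclesMap (g : C(X, Y)) {A : Set X} {B : Set Y} (h : Set.MapsTo g A B)
    (n : ℕ) : (relBoundaries A n).comap (relCycles A n).subtype ≤
      ((relBoundaries B n).comap (relCycles B n).subtype).comap (cyclesMap g h n) :=
  fun _ hc => chainMap_mem_relBoundaries g h n hc

/-- The homomorphism `g_* : H_n(X, A) → H_n(Y, B)` induced by a map of pairs. -/
def RelHomology.map (g : C(X, Y)) {A : Set X} {B : Set Y} (h : Set.MapsTo g A B) (n : ℕ) :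
    RelHomology A n →ₗ[ℤ] RelHomology B n :=
  Submodule.mapQ _ _ (cyclesMap g h n) (comap_le_comap_cyclesMap g h n)

theorem single_mem_relCycles {A : Set X} {n : ℕ} (σ : SingularSimplex X n)
    (hσ : ∀ t : stdSimplex ℝ (Fin (n + 1)), (∃ i, t i = 0) → σ t ∈ A) :
    (Finsupp.single σ 1 : Chain X n) ∈ relCycles A n := by
  cases n with
  | zero => exact Submodule.mem_top
  | succ n =>
    change boundary X n (Finsupp.single σ 1) ∈ chainsIn A n
    rw [boundary, LinearMap.sum_apply]
    refine Submodule.sum_mem _ fun i _ => ?_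
    rw [LinearMap.smul_apply, Finsupp.lmapDomain_apply, Finsupp.mapDomain_single]
    refine Submodule.smul_mem _ _ (Finsupp.single_mem_supported ℤ _ ?_)
    refine fun t => hσ _ ⟨i, ?_⟩
    change (stdSimplex.map i.succAbove t) i = 0
    rw [stdSimplex.map_coe, FunOnFinite.linearMap_apply_apply]
    refine Finset.sum_eq_zero fun j hj => ?_
    exact absurd (Finset.mem_filter.1 hj).2 (Fin.succAbove_ne i j)

/-- The class in `H_n(X, A)` of a singular simplex of `X` that maps the boundary of the standard
simplex into `A`. -/
def RelHomology.ofSimplex {A : Set X} {n : ℕ} (σ : SingularSimplex X n)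
    (hσ : ∀ t : stdSimplex ℝ (Fin (n + 1)), (∃ i, t i = 0) → σ t ∈ A) : RelHomology A n :=
  Submodule.Quotient.mk ⟨Finsupp.single σ 1, single_mem_relCycles σ hσ⟩

end Map

/-! ### Fundamental classes at a point of a vector space -/

section Simplex

variable {E : Type*} [NormedAddCommGroup E] [NormedSpace ℝ E]

/-- `w` lists the vertices of a nondegenerate simplex with barycenter `0`. -/
structure IsCenteredSimplex {n : ℕ} (w : Fin (n + 1) → E) : Prop where
  affineIndependent : AffineIndependent ℝ w
  sum_eq_zero : ∑ j, w j = 0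

/-- The affine singular simplex with vertices `p + w 0, …, p + w n`. -/
def affineSimplex {n : ℕ} (p : E) (w : Fin (n + 1) → E) : SingularSimplex E n where
  toFun t := p + ∑ j, t j • w j
  continuous_toFun := by
    refine continuous_const.add (continuous_finsetSum _ fun j _ => ?_)
    exact ((continuous_apply j).comp continuous_subtype_val).smul continuous_const

/-- The boundary of an affine simplex with barycenter `p` does not contain `p`. -/
theorem affineSimplex_ne {n : ℕ} (p : E) {w : Fin (n + 1) → E} (hw : IsCenteredSimplex w)
    (t : stdSimplex ℝ (Fin (n + 1))) (ht : ∃ i, t i = 0) : affineSimplex p w t ≠ p := by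
  obtain ⟨i, hi⟩ := ht
  intro h
  have h0 : ∑ j, t j • w j = 0 := by simpa [affineSimplex] using h
  have hN : ((n : ℝ) + 1) ≠ 0 := by positivity
  have hzero := (affineIndependent_iff.1 hw.affineIndependent) Finset.univ
    (fun j => t j - ((n : ℝ) + 1)⁻¹)
    (by simp [Finset.sum_sub_distrib, hN])
    (by simp [sub_smul, Finset.sum_sub_distrib, h0, ← Finset.smul_sum, hw.sum_eq_zero])
    i (Finset.mem_univ i)
  rw [hi, zero_sub, neg_eq_zero] at hzero
  exact inv_ne_zero hN hzero

/-- The fundamental class in `H_n(E, E ∖ {0})`, `n = dim E`, represented by an affine simplex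
with barycenter `0`. -/
def originClass (w : Fin (Module.finrank ℝ E + 1) → E) (hw : IsCenteredSimplex w) :
    RelHomology ({0}ᶜ : Set E) (Module.finrank ℝ E) :=
  RelHomology.ofSimplex (affineSimplex 0 w) fun t ht => affineSimplex_ne 0 hw t ht

/-- The fundamental class in `H_n(V, V ∖ {p})`, `n = dim E`, represented by an affine simplex
with barycenter `p` contained in `V`. It is the translate of `originClass w`, so that both classes
belong to the same orientation of `E`. -/
def pointClass (V : Set E) (p : E) (w : Fin (Module.finrank ℝ E + 1) → E)
    (hw : IsCenteredSimplex w) (hV : ∀ t, affineSimplex p w t ∈ V) :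
    RelHomology ({y : V | (y : E) ≠ p}) (Module.finrank ℝ E) :=
  RelHomology.ofSimplex
    ⟨fun t => ⟨affineSimplex p w t, hV t⟩, (affineSimplex p w).continuous.subtype_mk _⟩
    fun t ht => affineSimplex_ne p hw t ht

end Simplex

/-! ### The fixed point index at an isolated fixed point -/

section Index

variable {E : Type*} [NormedAddCommGroup E] [NormedSpace ℝ E]
  {H : Type*} [TopologicalSpace H] (I : ModelWithCorners ℝ E H)
  {X : Type*} [TopologicalSpace X] [ChartedSpace H X]

/-- The self-map `F` read in the chart at `p`. -/
def inChart (F : X → X) (p : X) : E → E :=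
  fun y => extChartAt I p (F ((extChartAt I p).symm y))

/-- `V` is an open neighbourhood of `p`, read in the chart at `p`, on which the coordinate
expression of `F` is defined and continuous and has `p` as its only fixed point. -/
structure IsIsolating (F : X → X) (p : X) (V : Set E) : Prop where
  isOpen : IsOpen V
  mem : extChartAt I p p ∈ V
  subset_target : V ⊆ (extChartAt I p).target
  mapsTo_source : ∀ y ∈ V, F ((extChartAt I p).symm y) ∈ (extChartAt I p).source
  continuousOn : ContinuousOn (inChart I F p) V
  fixed_iff : ∀ y ∈ V, inChart I F p y = y ↔ y = extChartAt I p p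

variable {I}

/-- The map `id - F : V → E` in the chart at `p`. -/
def IsIsolating.idSub {F : X → X} {p : X} {V : Set E} (hV : IsIsolating I F p V) : C(V, E) :=
  ⟨fun y => (y : E) - inChart I F p y, continuous_subtype_val.sub hV.continuousOn.domRestrict⟩

theorem IsIsolating.mapsTo_idSub {F : X → X} {p : X} {V : Set E} (hV : IsIsolating I F p V) :
    Set.MapsTo hV.idSub {y : V | (y : E) ≠ extChartAt I p p} ({0}ᶜ : Set E) := by
  intro y hy h
  exact hy ((hV.fixed_iff y y.2).1 (sub_eq_zero.1 h).symm)

variable (I)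

/-- `HasFixedPointIndex I F p i`: the point `p` is an isolated fixed point of `F` and its fixed
point index `i(F, p)` is the integer `i`, that is, in the chart at `p` the homomorphism
`(id - F)_* : H_n(V, V ∖ {p}) → H_n(E, E ∖ {0})`, `n = dim E`, sends the fundamental class at `p`
to `i` times the fundamental class at `0`. Such an integer is unique, because `H_n(E, E ∖ {0})` is
infinite cyclic and generated by the latter class. The equation is required of all isolating
neighbourhoods `V` and of all centered simplices representing the fundamental classes. -/
def HasFixedPointIndex (F : X → X) (p : X) (i : ℤ) : Prop :=
  (∃ V, IsIsolating I F p V) ∧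
    ∀ (V : Set E) (hV : IsIsolating I F p V) (w : Fin (Module.finrank ℝ E + 1) → E)
      (hw : IsCenteredSimplex w) (hwV : ∀ t, affineSimplex (extChartAt I p p) w t ∈ V),
      RelHomology.map hV.idSub hV.mapsTo_idSub (Module.finrank ℝ E)
          (pointClass V (extChartAt I p p) w hw hwV) = i • originClass w hw

/-- The differential `D_p F` at a fixed point `p` of `F`, an endomorphism of the tangent space at
`p`. (Tangent spaces are copies of the model space `E`, identified with it through the preferred
chart at the base point; since `F p = p`, source and target are identified through the same
chart.) -/
def tangentEnd (F : X → X) (p : X) : E →L[ℝ] E := mfderiv I I F p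

/-- All fixed points of `F` are generic: `det (I - D_p F) ≠ 0` whenever `F p = p`. -/
def HasOnlyGenericFixedPoints (F : X → X) : Prop :=
  ∀ p, F p = p → (ContinuousLinearMap.id ℝ E - tangentEnd I F p).det ≠ 0

/-- The fixed point class `[x]` of `F`: the fixed points `y` that can be joined to the fixed point
`x` by a path `γ` homotopic to `F ∘ γ` relative to the endpoints. (The existence of `γ'` forces
`F x = x` and `F y = y`.) -/
def fixedPointClass (F : X → X) (x : X) : Set X :=
  {y | ∃ γ γ' : Path x y, (∀ t, γ' t = F (γ t)) ∧ γ.Homotopic γ'}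

/-- `HasClassIndex I F x i`: the fixed point class `[x]` of `F` consists of finitely many isolated
fixed points, and its index `i(F, [x])`, the sum of their indices, is `i`. -/
def HasClassIndex (F : X → X) (x : X) (i : ℤ) : Prop :=
  ∃ (s : Finset X) (j : X → ℤ), (s : Set X) = fixedPointClass F x ∧
    (∀ y ∈ s, HasFixedPointIndex I F y (j y)) ∧ ∑ y ∈ s, j y = i

end Index

/-! ### Fuller maps -/

section Fuller

variable {M : Type*}

/-- The generator of the cyclic group acting on `M^n`:
`(x₁, …, xₙ) ↦ (xₙ, x₁, …, xₙ₋₁)`. -/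
def rotate (n : ℕ) (x : Fin n → M) : Fin n → M := fun j => x ((finRotate n).symm j)

/-- The Fuller map `Φₙ(f) : (x₁, …, xₙ) ↦ (f(xₙ), f(x₁), …, f(xₙ₋₁))`. -/
def fuller (f : M → M) (n : ℕ) (x : Fin n → M) : Fin n → M :=
  fun j => f (x ((finRotate n).symm j))

/-- The point `(x, f(x), …, f^{l-1}(x))` of `M^l`. -/
def orbitPoint (f : M → M) (l : ℕ) (x : M) : Fin l → M := fun j => f^[j] x

variable (M) in
/-- The fixed point set `(M^n)^{ℤ_k}` for `n = k * l`, where `ℤ_k ≤ ℤ_n` is the subgroup of order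
`k`, generated by the `l`-th power of the generator of `ℤ_n`. -/
def FixedSet (k l : ℕ) : Type _ := {x : Fin (k * l) → M // (rotate (k * l))^[l] x = x}

instance [TopologicalSpace M] (k l : ℕ) : TopologicalSpace (FixedSet M k l) :=
  inferInstanceAs (TopologicalSpace {x : Fin (k * l) → M // (rotate (k * l))^[l] x = x})

theorem fuller_rotate (f : M → M) (n : ℕ) (x : Fin n → M) :
    fuller f n (rotate n x) = rotate n (fuller f n x) := rfl

/-- The map `Φₙᵏ(f)`, the restriction of `Φₙ(f)` to `(M^n)^{ℤ_k}`, `n = k * l`. -/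
def fullerFixed (f : M → M) (k l : ℕ) (x : FixedSet M k l) : FixedSet M k l :=
  ⟨fuller f (k * l) x.1, by
    have h : Function.Commute (fuller f (k * l)) (rotate (M := M) (k * l)) :=
      fun y => fuller_rotate f _ y
    rw [← (h.iterate_right l).eq, x.2]⟩

theorem rotate_iterate_apply (n : ℕ) (x : Fin n → M) (l : ℕ) (j : Fin n) :
    (rotate n)^[l] x ((finRotate n ^ l) j) = x j := by
  induction l generalizing x with
  | zero => rfl
  | succ l ih =>
    rw [Function.iterate_succ_apply', pow_succ', Equiv.Perm.mul_apply]
    change (rotate n)^[l] x ((finRotate n).symm (finRotate n _)) = x j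
    rw [Equiv.symm_apply_apply, ih]

theorem coe_finRotate_pow (n l : ℕ) (j : Fin n) :
    ((finRotate n ^ l) j : ℕ) = (j + l) % n := by
  obtain _ | n := n
  · exact j.elim0
  induction l with
  | zero => simp [Nat.mod_eq_of_lt j.2]
  | succ l ih =>
    rw [pow_succ', Equiv.Perm.mul_apply, finRotate_apply, Fin.val_add, ih]
    simp [← add_assoc]

theorem rotate_iterate_repeat (k l : ℕ) (y : Fin l → M) :
    (rotate (k * l))^[l] (Fin.repeat k y) = Fin.repeat k y := by
  funext j
  obtain ⟨i, rfl⟩ := (finRotate (k * l) ^ l).surjective j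
  rw [rotate_iterate_apply]
  refine congrArg y (Fin.ext ?_)
  change (i : ℕ) % l = ((finRotate (k * l) ^ l) i : ℕ) % l
  rw [coe_finRotate_pow, Nat.mod_mod_of_dvd _ (Dvd.intro_left k rfl), Nat.add_mod_right]

theorem FixedSet.apply_eq {k l : ℕ} (x : FixedSet M k l) (q r : ℕ) (h : r + q * l < k * l)
    (h' : r < k * l) : x.1 ⟨r + q * l, h⟩ = x.1 ⟨r, h'⟩ := by
  induction q with
  | zero => simp
  | succ q ih =>
    have hq : r + q * l < k * l := lt_of_le_of_lt (by gcongr; omega) h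
    rw [← ih hq]
    have := rotate_iterate_apply (k * l) x.1 l ⟨r + q * l, hq⟩
    rw [x.2] at this
    rw [← this]
    refine congrArg x.1 (Fin.ext ?_)
    rw [coe_finRotate_pow]
    have e : r + (q + 1) * l = r + q * l + l := by ring
    simp only [e] at h ⊢
    rw [Nat.mod_eq_of_lt h]

/-- The identification `M^l ≅ (M^n)^{ℤ_k}`, `n = k * l`, which repeats a tuple `k` times. -/
def repeatHomeomorph [TopologicalSpace M] (k l : ℕ) [NeZero k] :
    (Fin l → M) ≃ₜ FixedSet M k l where
  toFun y := ⟨Fin.repeat k y, rotate_iterate_repeat k l y⟩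
  invFun x := fun i => x.1 (Fin.castLE (Nat.le_mul_of_pos_left l (NeZero.pos k)) i)
  left_inv y := by
    funext i
    exact congrArg y (Fin.ext (Nat.mod_eq_of_lt i.2))
  right_inv x := by
    refine Subtype.ext (funext fun j => ?_)
    have hj : (j : ℕ) % l + (j : ℕ) / l * l = j := Nat.mod_add_div' _ _
    have := FixedSet.apply_eq x ((j : ℕ) / l) ((j : ℕ) % l) (hj.symm ▸ j.2)
      (lt_of_le_of_lt (Nat.mod_le _ _) j.2)
    refine this.symm.trans (congrArg x.1 (Fin.ext hj))
  continuous_toFun := Continuous.subtype_mk (continuous_pi fun _ => continuous_apply _) _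
  continuous_invFun :=
    continuous_pi fun _ => (continuous_apply _).comp continuous_subtype_val

/-- The manifold structure of `(M^n)^{ℤ_k}`: the charts of `M^l`, carried over by the
identification `M^l ≅ (M^n)^{ℤ_k}`. -/
instance fixedSetChartedSpace {H : Type*} [TopologicalSpace H] [TopologicalSpace M]
    [ChartedSpace H M] (k l : ℕ) [NeZero k] :
    ChartedSpace (ModelPi fun _ : Fin l => H) (FixedSet M k l) where
  atlas := (fun c => (repeatHomeomorph k l).symm.toOpenPartialHomeomorph.trans c) ''
    atlas (ModelPi fun _ : Fin l => H) (Fin l → M)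
  chartAt p := (repeatHomeomorph k l).symm.toOpenPartialHomeomorph.trans
    (chartAt (ModelPi fun _ : Fin l => H) ((repeatHomeomorph k l).symm p))
  mem_chart_source p := by simp
  chart_mem_atlas p := ⟨_, chart_mem_atlas _ _, rfl⟩

end Fuller

end FixedPointIndex

end

noncomputable section

namespace FixedPointIndex

/-! ### Homotopic simplices represent the same relative class -/

section Prism

variable {X : Type*} [TopologicalSpace X]

/-! All three point indices equal one number, the sign of `det (1 - D_x f^l)`.

At a fixed point `p` where `1 - D_p F` is invertible, the index is the sign of `det (1 - D_p F)`
(`hasFixedPointIndex_of_hasFDerivAt`). Rescaling deforms `id - F` on a small simplex into its linear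
part without its boundary meeting the origin, and a linear automorphism multiplies the class of a
centered simplex by the sign of its determinant (`actsBySign_of_det_ne_zero`). Both facts are proved
on chains, from a prism decomposition and a degenerate simplex; the group `H_n(E, E ∖ {0})` itself
is never computed.

The differential of the Fuller map at the orbit of `x` is a cyclic block operator with the
differentials of `f` along the orbit as blocks. Its `det (1 - ·)` collapses to that of the product
of the blocks, which is `D_x f^l` by the chain rule (`det_id_sub_fullerDeriv`). In the charts
carried over to the fixed point set, the restricted Fuller map has the same coordinate expression as
the one on `M^l`.

For classes, `x ↦ (x, f x, …)` carries the class of `x` onto the class of its orbit point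
(`fixedPointClass_fuller`), and repetition conjugates the two Fuller maps (`fullerFixed_repeat`).
Compactness makes the classes finite, so the three sums agree term by term. -/

theorem boundary_single {n : ℕ} (σ : SingularSimplex X (n + 1)) :
    boundary X n (Finsupp.single σ 1) =
      ∑ i : Fin (n + 2), ((-1 : ℤ) ^ (i : ℕ)) • Finsupp.single (σ.comp (faceMap n i)) 1 := by
  simp only [boundary, LinearMap.sum_apply, LinearMap.smul_apply, Finsupp.lmapDomain_apply,
    Finsupp.mapDomain_single]

theorem RelHomology.ofSimplex_eq_iff {A : Set X} {n : ℕ} {σ τ : SingularSimplex X n}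
    {hσ : ∀ t : stdSimplex ℝ (Fin (n + 1)), (∃ i, t i = 0) → σ t ∈ A}
    {hτ : ∀ t : stdSimplex ℝ (Fin (n + 1)), (∃ i, t i = 0) → τ t ∈ A} :
    RelHomology.ofSimplex σ hσ = RelHomology.ofSimplex τ hτ ↔
      (Finsupp.single σ 1 - Finsupp.single τ 1 : Chain X n) ∈ relBoundaries A n :=
  Submodule.Quotient.eq _

theorem faceMap_apply {n : ℕ} (i : Fin (n + 2)) (t : stdSimplex ℝ (Fin (n + 1)))
    (j : Fin (n + 1)) : faceMap n i t (i.succAbove j) = t j := by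
  change (stdSimplex.map i.succAbove t) (i.succAbove j) = t j
  rw [stdSimplex.map_coe, FunOnFinite.linearMap_apply_apply, Finset.sum_eq_single j]
  · intro b hb hbj
    exact absurd (Fin.succAbove_right_injective (Finset.mem_filter.1 hb).2) hbj
  · simp

theorem faceMap_apply_self {n : ℕ} (i : Fin (n + 2)) (t : stdSimplex ℝ (Fin (n + 1))) :
    faceMap n i t i = 0 := by
  change (stdSimplex.map i.succAbove t) i = 0
  rw [stdSimplex.map_coe, FunOnFinite.linearMap_apply_apply]
  exact Finset.sum_eq_zero fun j hj => absurd (Finset.mem_filter.1 hj).2 (Fin.succAbove_ne i j)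

theorem sum_faceMap {n : ℕ} {V : Type*} [AddCommGroup V] [Module ℝ V] (i : Fin (n + 2))
    (t : stdSimplex ℝ (Fin (n + 1))) (v : Fin (n + 2) → V) :
    ∑ j, faceMap n i t j • v j = ∑ j, t j • v (i.succAbove j) := by
  rw [Fin.sum_univ_succAbove _ i, faceMap_apply_self, zero_smul, zero_add]
  simp only [faceMap_apply]

theorem stdSimplex_map_apply {n m : ℕ} (u : Fin m → Fin n) (t : stdSimplex ℝ (Fin m))
    (i : Fin n) : stdSimplex.map u t i = ∑ j, t j • if u j = i then (1 : ℝ) else 0 := by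
  rw [stdSimplex.map_coe, FunOnFinite.linearMap_apply_apply, Finset.sum_filter]
  simp

/-- The affine map from a simplex to the prism `Δⁿ × [0, 1]` sending the `j`-th vertex to
`(u j, 0)` or `(u j, 1)`, according to whether `e j` holds. -/
def prismMap {m n : ℕ} (u : Fin m → Fin n) (e : Fin m → Prop) [DecidablePred e] :
    C(stdSimplex ℝ (Fin m), stdSimplex ℝ (Fin n) × unitInterval) where
  toFun t := (stdSimplex.map u t, ⟨∑ j, t j • if e j then (1 : ℝ) else 0, by
    constructor
    · exact Finset.sum_nonneg fun j _ => mul_nonneg (stdSimplex.zero_le t j) (by split_ifs <;> simp)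
    · rw [← stdSimplex.sum_eq_one t]
      refine Finset.sum_le_sum fun j _ => ?_
      have := stdSimplex.zero_le t j
      split_ifs <;> simp [this]⟩)
  continuous_toFun := by
    refine (stdSimplex.continuous_map u).prodMk (Continuous.subtype_mk ?_ _)
    refine continuous_finsetSum _ fun j _ => ?_
    exact ((continuous_apply j).comp continuous_subtype_val).smul continuous_const

/-- Both sides are affine, hence determined by their vertices. This turns every face computation in
the prism into index arithmetic. -/
theorem prismMap_comp_faceMap {m n : ℕ} (u : Fin (m + 2) → Fin n) (e : Fin (m + 2) → Prop)
    [DecidablePred e] (i : Fin (m + 2)) :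
    (prismMap u e).comp (faceMap m i) =
      prismMap (u ∘ i.succAbove) (fun j => e (i.succAbove j)) := by
  ext t : 1
  refine Prod.ext (stdSimplex.ext (funext fun k => ?_)) (Subtype.ext ?_)
  · change stdSimplex.map u (faceMap m i t) k = stdSimplex.map (u ∘ i.succAbove) t k
    rw [stdSimplex_map_apply, stdSimplex_map_apply, sum_faceMap]
    rfl
  · exact sum_faceMap i t _

variable {n : ℕ} (h : C(stdSimplex ℝ (Fin (n + 1)) × unitInterval, X))

/-- The intermediate slice of the prism, whose `j`-th vertex has height one if and only if
`i ≤ j`. -/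
def slice (i : ℕ) : SingularSimplex X n := h.comp (prismMap id fun j => i ≤ (j : ℕ))

/-- The `i`-th simplex of the triangulation of the prism. -/
def prismSimplex (i : Fin (n + 1)) : SingularSimplex X (n + 1) :=
  h.comp (prismMap i.predAbove fun j => i.castSucc < j)

theorem val_succAbove_eq {m : ℕ} (i : Fin (m + 1)) (j : Fin m) :
    (i.succAbove j : ℕ) = if (j : ℕ) < i then (j : ℕ) else j + 1 := by
  simp only [Fin.succAbove, Fin.lt_def, Fin.val_castSucc]
  split_ifs <;> simp

theorem val_predAbove_eq {m : ℕ} (i : Fin m) (j : Fin (m + 1)) :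
    (i.predAbove j : ℕ) = if (i : ℕ) < j then (j : ℕ) - 1 else j := by
  simp only [Fin.predAbove, Fin.lt_def, Fin.val_castSucc]
  split_ifs <;> simp

theorem prismSimplex_face_castSucc (i : Fin (n + 1)) :
    (prismSimplex h i).comp (faceMap n i.castSucc) = slice h i := by
  rw [prismSimplex, ContinuousMap.comp_assoc, prismMap_comp_faceMap, slice]
  congr 2
  · funext j
    simp
  · funext j
    simp only [Fin.lt_def, val_succAbove_eq, Fin.val_castSucc, eq_iff_iff]
    split_ifs <;> omega

theorem prismSimplex_face_succ (i : Fin (n + 1)) :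
    (prismSimplex h i).comp (faceMap n i.succ) = slice h (i + 1) := by
  rw [prismSimplex, ContinuousMap.comp_assoc, prismMap_comp_faceMap, slice]
  congr 2
  · funext j
    simp only [Function.comp_apply, Fin.ext_iff, val_predAbove_eq, val_succAbove_eq,
      Fin.val_succ, id_eq]
    split_ifs <;> omega
  · funext j
    simp only [Fin.lt_def, val_succAbove_eq, Fin.val_castSucc, Fin.val_succ, eq_iff_iff]
    split_ifs <;> omega

/-- The vertices of the prism simplex lie over `0, …, i, i, i + 1, …, n`. Deleting one that is not a
copy of `i` leaves its image uncovered, so the face lies over the boundary of the base simplex. -/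
theorem prismSimplex_face_mem {A : Set X}
    (hA : ∀ t : stdSimplex ℝ (Fin (n + 1)), (∃ i, t i = 0) → ∀ s, h (t, s) ∈ A)
    (i : Fin (n + 1)) (j : Fin (n + 2)) (hj : j ≠ i.castSucc) (hj' : j ≠ i.succ) :
    (Finsupp.single ((prismSimplex h i).comp (faceMap n j)) 1 : Chain X n) ∈ chainsIn A n := by
  refine Finsupp.single_mem_supported ℤ _ fun t => ?_
  rw [prismSimplex, ContinuousMap.comp_assoc, prismMap_comp_faceMap]
  refine hA _ ⟨i.predAbove j, ?_⟩ _
  rw [stdSimplex_map_apply]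
  refine Finset.sum_eq_zero fun b _ => ?_
  rw [if_neg, smul_zero]
  simp only [Function.comp_apply, val_predAbove_eq, val_succAbove_eq, Fin.ext_iff,
    ne_eq, Fin.val_castSucc, Fin.val_succ] at hj hj' ⊢
  split_ifs <;> omega

/-- Consecutive slices are the two faces of one prism simplex obtained by deleting either copy of
the vertex `i`. They carry opposite signs in its boundary, and the remaining faces lie in `A`. -/
theorem slice_sub_slice_mem {A : Set X}
    (hA : ∀ t : stdSimplex ℝ (Fin (n + 1)), (∃ i, t i = 0) → ∀ s, h (t, s) ∈ A)
    (i : Fin (n + 1)) :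
    (Finsupp.single (slice h i) 1 - Finsupp.single (slice h (i + 1)) 1 : Chain X n) ∈
      relBoundaries A n := by
  have key : boundary X n (((-1 : ℤ) ^ (i : ℕ)) • Finsupp.single (prismSimplex h i) 1) -
      (Finsupp.single (slice h i) 1 - Finsupp.single (slice h (i + 1)) 1) ∈ chainsIn A n := by
    have hne : i.castSucc ≠ i.succ := (Fin.castSucc_lt_succ (i := i)).ne
    rw [map_smul, boundary_single, ← Finset.add_sum_erase _ _ (Finset.mem_univ i.castSucc),
      ← Finset.add_sum_erase _ _ (Finset.mem_erase.2 ⟨hne.symm, Finset.mem_univ i.succ⟩),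
      prismSimplex_face_castSucc, prismSimplex_face_succ]
    simp only [smul_add, smul_smul, Fin.val_castSucc, Fin.val_succ, ← pow_add, ← add_assoc]
    rw [Even.neg_one_pow ⟨(i : ℕ), rfl⟩, Odd.neg_one_pow (by exact ⟨(i : ℕ), by ring⟩)]
    have hs : ∀ a b c : Chain X n, (1 : ℤ) • a + (-1 : ℤ) • b + c - (a - b) = c := by
      intro a b c
      simp only [one_smul, neg_smul]
      abel
    rw [hs]
    refine Submodule.smul_mem _ _ (Submodule.sum_mem _ fun j hj => Submodule.smul_mem _ _ ?_)
    simp only [Finset.mem_erase] at hj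
    exact prismSimplex_face_mem h hA i j hj.2.1 hj.1
  have := Submodule.sub_mem _ (Submodule.mem_sup_left (T := chainsIn A n)
    (LinearMap.mem_range_self (boundary X n)
      (((-1 : ℤ) ^ (i : ℕ)) • Finsupp.single (prismSimplex h i) 1)))
    (Submodule.mem_sup_right key)
  rwa [sub_sub_cancel] at this

theorem slice_zero : slice h 0 = h.comp ((ContinuousMap.id _).prodMk (.const _ 1)) := by
  refine congrArg h.comp ?_
  ext t : 1
  refine Prod.ext (stdSimplex.map_id_apply t) (Subtype.ext ?_)
  change ∑ j, t j • (if 0 ≤ (j : ℕ) then (1 : ℝ) else 0) = 1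
  simp

theorem slice_last : slice h (n + 1) = h.comp ((ContinuousMap.id _).prodMk (.const _ 0)) := by
  refine congrArg h.comp ?_
  ext t : 1
  refine Prod.ext (stdSimplex.map_id_apply t) (Subtype.ext ?_)
  change ∑ j : Fin (n + 1), t j • (if n + 1 ≤ (j : ℕ) then (1 : ℝ) else 0) = 0
  exact Finset.sum_eq_zero fun j _ => by rw [if_neg (by omega), smul_zero]

/-- Simplices that are homotopic through simplices with boundary in `A` represent the same class
relative to `A`. -/
theorem RelHomology.ofSimplex_eq_of_homotopy {A : Set X} {σ τ : SingularSimplex X n}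
    (hA : ∀ t : stdSimplex ℝ (Fin (n + 1)), (∃ i, t i = 0) → ∀ s, h (t, s) ∈ A)
    (h0 : ∀ t, h (t, 0) = σ t) (h1 : ∀ t, h (t, 1) = τ t)
    (hσ : ∀ t : stdSimplex ℝ (Fin (n + 1)), (∃ i, t i = 0) → σ t ∈ A)
    (hτ : ∀ t : stdSimplex ℝ (Fin (n + 1)), (∃ i, t i = 0) → τ t ∈ A) :
    RelHomology.ofSimplex σ hσ = RelHomology.ofSimplex τ hτ := by
  -- The slices start at the top of the prism, so the telescoping sum is `τ - σ`.
  symm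
  rw [RelHomology.ofSimplex_eq_iff]
  have e0 : slice h 0 = τ := by rw [slice_zero]; ext t; exact h1 t
  have e1 : slice h (n + 1) = σ := by rw [slice_last]; ext t; exact h0 t
  rw [← e0, ← e1]
  have := Submodule.sum_mem (relBoundaries A n) (t := Finset.univ)
    fun i _ => slice_sub_slice_mem h hA i
  rwa [Fin.sum_univ_eq_sum_range
    (fun i => (Finsupp.single (slice h i) 1 - Finsupp.single (slice h (i + 1)) 1 : Chain X n)),
    Finset.sum_range_sub'] at this

end Prism

/-! ### Affine simplices with barycenter at the origin, and linear automorphisms -/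

section LinearAction

variable {E : Type*} [NormedAddCommGroup E] [NormedSpace ℝ E] {n : ℕ}

/-- The class in `H_n(E, E ∖ {0})` of an affine `n`-simplex with barycenter `0`. -/
def centeredClass (w : Fin (n + 1) → E) (hw : IsCenteredSimplex w) :
    RelHomology ({0}ᶜ : Set E) n :=
  RelHomology.ofSimplex (affineSimplex 0 w) fun t ht => affineSimplex_ne 0 hw t ht

theorem centeredClass_congr {w w' : Fin (n + 1) → E} (h : w = w') (hw : IsCenteredSimplex w) :
    centeredClass w hw = centeredClass w' (h ▸ hw) := by
  subst h
  rfl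

theorem RelHomology.map_ofSimplex {X Y : Type*} [TopologicalSpace X] [TopologicalSpace Y]
    (g : C(X, Y)) {A : Set X} {B : Set Y} (h : Set.MapsTo g A B) (σ : SingularSimplex X n)
    (hσ : ∀ t : stdSimplex ℝ (Fin (n + 1)), (∃ i, t i = 0) → σ t ∈ A) :
    RelHomology.map g h n (RelHomology.ofSimplex σ hσ) =
      RelHomology.ofSimplex (g.comp σ) fun t ht => h (hσ t ht) := by
  refine congrArg (Submodule.Quotient.mk (p := (relBoundaries B n).comap
    (relCycles B n).subtype)) (Subtype.ext ?_)
  change chainMap g n (Finsupp.single σ 1) = Finsupp.single (g.comp σ) 1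
  rw [chainMap, Finsupp.lmapDomain_apply, Finsupp.mapDomain_single]

theorem affineSimplex_zero_apply (w : Fin (n + 1) → E) (t : stdSimplex ℝ (Fin (n + 1))) :
    affineSimplex 0 w t = ∑ j, t j • w j :=
  zero_add _

theorem affineSimplex_comp_faceMap (w : Fin (n + 2) → E) (i : Fin (n + 2)) :
    (affineSimplex 0 w).comp (faceMap n i) = affineSimplex 0 (w ∘ i.succAbove) := by
  ext t : 1
  rw [ContinuousMap.comp_apply, affineSimplex_zero_apply, affineSimplex_zero_apply, sum_faceMap]
  rfl

theorem IsCenteredSimplex.map {w : Fin (n + 1) → E} (hw : IsCenteredSimplex w)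
    (A : E →ₗ[ℝ] E) (hA : Function.Injective A) : IsCenteredSimplex (A ∘ w) where
  affineIndependent := hw.affineIndependent.map' A.toAffineMap hA
  sum_eq_zero := by
    simp only [Function.comp_apply]
    rw [← map_sum, hw.sum_eq_zero, map_zero]

theorem IsCenteredSimplex.comp_perm {w : Fin (n + 1) → E} (hw : IsCenteredSimplex w)
    (σ : Equiv.Perm (Fin (n + 1))) : IsCenteredSimplex (w ∘ σ) where
  affineIndependent := hw.affineIndependent.comp_embedding σ.toEmbedding
  sum_eq_zero := by rw [← hw.sum_eq_zero]; exact Equiv.sum_comp σ w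

/-- Moving the vertices is a homotopy of simplices; the boundary avoids the origin at each time
because the simplex stays nondegenerate with barycenter `0`. -/
theorem centeredClass_eq_of_path {W : unitInterval → Fin (n + 1) → E}
    (hc : ∀ j, Continuous fun s => W s j) (hW : ∀ s, IsCenteredSimplex (W s)) :
    centeredClass (W 0) (hW 0) = centeredClass (W 1) (hW 1) := by
  refine RelHomology.ofSimplex_eq_of_homotopy
    ⟨fun q => ∑ j, q.1 j • W q.2 j, continuous_finsetSum _ fun j _ => ?_⟩ ?_ ?_ ?_ _ _
  · exact ((continuous_apply j).comp (continuous_subtype_val.comp continuous_fst)).smul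
      ((hc j).comp continuous_snd)
  · intro t ht s
    have := affineSimplex_ne 0 (hW s) t ht
    rwa [affineSimplex_zero_apply] at this
  · exact fun t => (affineSimplex_zero_apply _ _).symm
  · exact fun t => (affineSimplex_zero_apply _ _).symm

theorem single_affineSimplex_mem_chainsIn {w : Fin (n + 1) → E} (hw : IsCenteredSimplex w)
    {m : ℕ} (u : Fin (m + 1) → Fin (n + 1)) (i : Fin (n + 1)) (hu : ∀ j, u j ≠ i) :
    (Finsupp.single (affineSimplex 0 (w ∘ u)) 1 : Chain E m) ∈ chainsIn ({0}ᶜ : Set E) m := by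
  refine Finsupp.single_mem_supported ℤ _ fun t => ?_
  have hne := affineSimplex_ne 0 hw (stdSimplex.map u t) ⟨i, by
    rw [stdSimplex_map_apply]
    exact Finset.sum_eq_zero fun j _ => by rw [if_neg (hu j), smul_zero]⟩
  have he : affineSimplex 0 (w ∘ u) t = affineSimplex 0 w (stdSimplex.map u t) := by
    simp only [affineSimplex_zero_apply, stdSimplex_map_apply, Finset.sum_smul]
    rw [Finset.sum_comm]
    refine Finset.sum_congr rfl fun j _ => ?_
    simp [ite_smul]
  rw [he]
  exact hne

/-- The vertex list `0, …, i, i + 1, i, i + 2, …` of a degenerate simplex. -/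
def foldVertex (i : Fin n) : Fin (n + 2) → Fin (n + 1) := fun j =>
  if (j : ℕ) = i + 2 then i.castSucc else i.succ.predAbove j

/-- In the boundary of the degenerate simplex with vertices `0, …, i, i + 1, i, i + 2, …`, deleting
the first `i` gives the swapped simplex and deleting the second gives the original. The two
positions differ by `2`, so the signs agree. Every other face omits a vertex and hence avoids the
origin. -/
theorem centeredClass_swap {w : Fin (n + 1) → E} (hw : IsCenteredSimplex w) (i : Fin n) :
    centeredClass (w ∘ Equiv.swap i.castSucc i.succ) (hw.comp_perm _) = -centeredClass w hw := by
  rw [eq_neg_iff_add_eq_zero]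
  refine (Submodule.Quotient.mk_eq_zero _).2 ?_
  change (Finsupp.single (affineSimplex 0 (w ∘ Equiv.swap i.castSucc i.succ)) 1 +
    Finsupp.single (affineSimplex 0 w) 1 : Chain E n) ∈ relBoundaries _ n
  have hface : ∀ j : Fin (n + 2), (affineSimplex 0 (w ∘ foldVertex i)).comp (faceMap n j) =
      affineSimplex 0 (w ∘ (foldVertex i ∘ j.succAbove)) := fun j =>
    affineSimplex_comp_faceMap _ _
  have hval : ∀ j : Fin (n + 2), (foldVertex i j : ℕ) =
      if (j : ℕ) = i + 2 then (i : ℕ) else if (i : ℕ) + 1 < j then (j : ℕ) - 1 else j := by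
    intro j
    rw [foldVertex]
    split_ifs with h1 h2 <;> simp [val_predAbove_eq] <;> omega
  have h0 : foldVertex i ∘ (i.castSucc.castSucc).succAbove = Equiv.swap i.castSucc i.succ := by
    funext j
    rw [Equiv.swap_apply_def]
    split_ifs with h1 h2 <;>
      simp only [Function.comp_apply, Fin.ext_iff, hval, val_succAbove_eq, Fin.val_castSucc,
        Fin.val_succ] at * <;> split_ifs <;> omega
  have h2 : foldVertex i ∘ (i.succ.succ).succAbove = id := by
    funext j
    simp only [Function.comp_apply, Fin.ext_iff, hval, val_succAbove_eq, Fin.val_succ, id_eq]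
    split_ifs <;> omega
  have hrest : ∀ j : Fin (n + 2), j ≠ i.castSucc.castSucc → j ≠ i.succ.succ →
      ∃ k, ∀ b, (foldVertex i ∘ j.succAbove) b ≠ k := by
    intro j hj hj'
    refine ⟨i.succ.predAbove j, fun b => ?_⟩
    simp only [Function.comp_apply, val_predAbove_eq, val_succAbove_eq, Fin.ext_iff, hval,
      ne_eq, Fin.val_castSucc, Fin.val_succ] at hj hj' ⊢
    split_ifs <;> omega
  have hne : i.castSucc.castSucc ≠ i.succ.succ := by
    simp only [ne_eq, Fin.ext_iff, Fin.val_castSucc, Fin.val_succ]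
    omega
  have key : boundary E n (((-1 : ℤ) ^ (i : ℕ)) •
      Finsupp.single (affineSimplex 0 (w ∘ foldVertex i)) 1) -
      (Finsupp.single (affineSimplex 0 (w ∘ Equiv.swap i.castSucc i.succ)) 1 +
        Finsupp.single (affineSimplex 0 w) 1) ∈ chainsIn ({0}ᶜ : Set E) n := by
    rw [map_smul, boundary_single,
      ← Finset.add_sum_erase _ _ (Finset.mem_univ i.castSucc.castSucc),
      ← Finset.add_sum_erase _ _ (Finset.mem_erase.2 ⟨hne.symm, Finset.mem_univ i.succ.succ⟩),
      hface, hface, h0, h2]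
    simp only [smul_add, smul_smul, Fin.val_castSucc, Fin.val_succ, ← pow_add, ← add_assoc]
    rw [Even.neg_one_pow ⟨(i : ℕ), rfl⟩, Even.neg_one_pow (by exact ⟨(i : ℕ) + 1, by ring⟩)]
    simp only [one_smul, Function.comp_id, add_sub_cancel_left]
    refine Submodule.smul_mem _ _ (Submodule.sum_mem _ fun j hj => Submodule.smul_mem _ _ ?_)
    simp only [Finset.mem_erase] at hj
    obtain ⟨k, hk⟩ := hrest j hj.2.1 hj.1
    rw [hface]
    exact single_affineSimplex_mem_chainsIn hw _ k hk
  have := Submodule.sub_mem _ (Submodule.mem_sup_left (T := chainsIn ({0}ᶜ : Set E) n)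
    (LinearMap.mem_range_self (boundary E n)
      (((-1 : ℤ) ^ (i : ℕ)) • Finsupp.single (affineSimplex 0 (w ∘ foldVertex i)) 1)))
    (Submodule.mem_sup_right key)
  rwa [sub_sub_cancel] at this

/-- Adjacent transpositions generate the permutations. The vertex list is quantified after `σ`
because the product case applies the hypothesis to a permuted list. -/
theorem centeredClass_perm (σ : Equiv.Perm (Fin (n + 1))) :
    ∀ {w : Fin (n + 1) → E} (hw : IsCenteredSimplex w),
      centeredClass (w ∘ σ) (hw.comp_perm σ) = (Equiv.Perm.sign σ : ℤ) • centeredClass w hw := by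
  have hσ : σ ∈ Submonoid.closure
      (Set.range fun i : Fin n => Equiv.swap i.castSucc i.succ) := by
    rw [Equiv.Perm.mclosure_swap_castSucc_succ]
    exact Submonoid.mem_top σ
  induction hσ using Submonoid.closure_induction with
  | mem x hx =>
    obtain ⟨i, rfl⟩ := hx
    intro w hw
    rw [centeredClass_swap hw, Equiv.Perm.sign_swap (Fin.castSucc_lt_succ (i := i)).ne]
    simp
  | one => intro w hw; simp
  | mul x y _ _ ihx ihy =>
    intro w hw
    rw [centeredClass_congr (w := w ∘ (x * y)) (w' := (w ∘ x) ∘ y) rfl,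
      ihy (hw.comp_perm x), ihx hw, smul_smul, map_mul, Units.val_mul, mul_comm]

/-- Since the vertices sum to zero, subtracting a constant `s` from all coefficients, including a
coefficient `0` at `w 0`, preserves a relation. With `s` their mean they sum to zero, so affine
independence makes each equal to `s`, and `w 0` gives `s = 0`. -/
theorem IsCenteredSimplex.linearIndependent {w : Fin (n + 1) → E} (hw : IsCenteredSimplex w) :
    LinearIndependent ℝ (w ∘ Fin.succ) := by
  rw [Fintype.linearIndependent_iff]
  intro c hc
  set s : ℝ := (∑ i, c i) / (n + 1) with hs
  have hN : ((n : ℝ) + 1) ≠ 0 := by positivity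
  have hg := affineIndependent_iff.1 hw.affineIndependent Finset.univ
    (fun j => (Fin.cons 0 c : Fin (n + 1) → ℝ) j - s)
    (by
      rw [Finset.sum_sub_distrib, Fin.sum_univ_succ]
      simp only [Fin.cons_zero, Fin.cons_succ, Finset.sum_const, Finset.card_univ,
        Fintype.card_fin, nsmul_eq_mul]
      push_cast
      rw [hs, mul_div_cancel₀ _ hN]
      ring)
    (by
      simp only [sub_smul, Finset.sum_sub_distrib]
      rw [Fin.sum_univ_succ, ← Finset.smul_sum, hw.sum_eq_zero]
      simpa using hc)
  have h0 := hg 0 (Finset.mem_univ _)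
  intro i
  have hi := hg i.succ (Finset.mem_univ _)
  simp only [Fin.cons_zero, Fin.cons_succ] at h0 hi
  linarith

/-- A linear map `A` acts on the class of `w` by the sign of its determinant. -/
def ActsBySign (w : Fin (n + 1) → E) (hw : IsCenteredSimplex w) (A : E →ₗ[ℝ] E) : Prop :=
  ∀ h : IsCenteredSimplex (A ∘ w),
    centeredClass (A ∘ w) h = (SignType.sign A.det : ℤ) • centeredClass w hw

variable {w : Fin (n + 1) → E} {hw : IsCenteredSimplex w}

theorem ActsBySign.of_path {A : unitInterval → E →ₗ[ℝ] E} (hc : ∀ v, Continuous fun s => A s v)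
    (hA : ∀ s, Function.Injective (A s))
    (hd : SignType.sign (A 0).det = SignType.sign (A 1).det) (h1 : ActsBySign w hw (A 1)) :
    ActsBySign w hw (A 0) := by
  intro h
  rw [centeredClass_eq_of_path (W := fun s => A s ∘ w) (fun j => hc (w j))
    fun s => hw.map (A s) (hA s), h1, hd]

theorem actsBySign_id : ActsBySign w hw LinearMap.id := by
  intro h
  simp

variable [FiniteDimensional ℝ E]

/-- The basis formed by all vertices but the first of a centered simplex. -/
def IsCenteredSimplex.basis (hw : IsCenteredSimplex w)
    (hn : n = Module.finrank ℝ E) : Module.Basis (Fin n) ℝ E :=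
  basisOfLinearIndependentOfCardEqFinrank' (w ∘ Fin.succ) hw.linearIndependent
    (by rw [Fintype.card_fin, hn])

theorem IsCenteredSimplex.basis_apply (hw : IsCenteredSimplex w)
    (hn : n = Module.finrank ℝ E) (i : Fin n) : hw.basis hn i = w i.succ := by
  simp [IsCenteredSimplex.basis]

theorem injective_of_det_ne_zero {A : E →ₗ[ℝ] E} (hA : A.det ≠ 0) : Function.Injective A :=
  (LinearMap.equivOfDetNeZero A hA).injective

/-- The hypothesis on `A` concerns only the simplex `w`, not `B ∘ w`. Pushing the relation between
the classes of `B ∘ w` and `w` forward along `A` bridges the gap. -/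
theorem ActsBySign.comp {A B : E →ₗ[ℝ] E} (hA : ActsBySign w hw A) (hB : ActsBySign w hw B)
    (hA0 : A.det ≠ 0) (hB0 : B.det ≠ 0) : ActsBySign w hw (A ∘ₗ B) := by
  intro h
  have hAi := injective_of_det_ne_zero hA0
  set g : C(E, E) := ⟨A, A.continuous_of_finiteDimensional⟩
  have hm : Set.MapsTo g ({0}ᶜ : Set E) ({0}ᶜ : Set E) := fun v hv hv0 =>
    hv ((map_eq_zero_iff A hAi).1 hv0)
  have hcl : ∀ (v : Fin (n + 1) → E) (hv : IsCenteredSimplex v),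
      RelHomology.map g hm n (centeredClass v hv) =
        centeredClass (A ∘ v) (hv.map A hAi) := by
    intro v hv
    refine (RelHomology.map_ofSimplex g hm _ _).trans ?_
    unfold centeredClass
    congr 1
    ext t
    change A (affineSimplex 0 v t) = _
    simp only [affineSimplex_zero_apply, map_sum, map_smul, Function.comp_apply]
  have hBc := hw.map B (injective_of_det_ne_zero hB0)
  change centeredClass (A ∘ (B ∘ w)) h = _
  rw [← hcl _ hBc, hB hBc, map_smul, hcl w hw,
    hA _, smul_smul, LinearMap.det_comp, sign_mul, mul_comm]
  simp

variable (hn : n = Module.finrank ℝ E)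

theorem injective_toLin (b : Module.Basis (Fin n) ℝ E) {N : Matrix (Fin n) (Fin n) ℝ}
    (hN : N.det ≠ 0) : Function.Injective (Matrix.toLin b b N) :=
  injective_of_det_ne_zero (by rwa [LinearMap.det_toLin])

theorem actsBySign_toLin_of_path (b : Module.Basis (Fin n) ℝ E)
    {N : unitInterval → Matrix (Fin n) (Fin n) ℝ} (hc : Continuous N) (hN : ∀ s, (N s).det ≠ 0)
    (hd : SignType.sign (N 0).det = SignType.sign (N 1).det)
    (h1 : ActsBySign w hw (Matrix.toLin b b (N 1))) :
    ActsBySign w hw (Matrix.toLin b b (N 0)) := by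
  refine ActsBySign.of_path (A := fun s => Matrix.toLin b b (N s)) (fun v => ?_)
    (fun s => injective_toLin b (hN s)) (by simpa only [LinearMap.det_toLin] using hd) h1
  simp only [Matrix.toLin_apply]
  refine continuous_finsetSum _ fun i _ => ?_
  exact ((continuous_apply i).comp (hc.matrix_mulVec continuous_const)).smul continuous_const

/-- The linear map negating the `i`-th vector of the basis of vertices. -/
theorem actsBySign_reflection (i : Fin n) :
    ActsBySign w hw (Matrix.toLin (hw.basis hn) (hw.basis hn)
      (Matrix.diagonal fun j => if j ∈ ({i} : Finset (Fin n)) then -1 else 1)) := by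
  set b := hw.basis hn with hb
  -- `A s` sends `b i` to `b i - u s` and fixes the other basis vectors. At `s = 0` this is the
  -- reflection; at `s = 1` it sends `b i` to `-∑ j, b j = w 0`, so it transposes two vertices and
  -- `centeredClass_perm` gives the sign.
  set u : unitInterval → E := fun s =>
    (2 : ℝ) • b i + (s : ℝ) • ∑ j ∈ Finset.univ.erase i, b j with hu
  set A : unitInterval → E →ₗ[ℝ] E := fun s =>
    LinearMap.id - (b.coord i).smulRight (u s) with hA
  have hAb : ∀ s j, A s (b j) = if j = i then b i - u s else b j := by
    intro s j
    simp only [hA, LinearMap.sub_apply, LinearMap.id_apply, LinearMap.smulRight_apply,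
      Module.Basis.coord_apply, Module.Basis.repr_self, Finsupp.single_apply]
    split_ifs with h
    · simp [h]
    · simp
  have h0 : A 0 = Matrix.toLin b b
      (Matrix.diagonal fun j => if j ∈ ({i} : Finset (Fin n)) then -1 else 1) := by
    refine b.ext fun j => ?_
    rw [hAb, Matrix.toLin_self, Finset.sum_eq_single j]
    · rw [Matrix.diagonal_apply_eq]
      by_cases h : j = i
      · subst h
        simp only [if_true, Finset.mem_singleton, hu, neg_smul, one_smul]
        simp only [Set.Icc.coe_zero, zero_smul, add_zero, two_smul]
        abel
      · simp [h]
    · intro k _ hk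
      rw [Matrix.diagonal_apply_ne _ hk, zero_smul]
    · simp
  have hφ : ∀ s, b.coord i (u s) = 2 := by
    intro s
    simp only [hu, map_add, map_smul, map_sum, Module.Basis.coord_apply, Module.Basis.repr_self]
    rw [Finset.sum_eq_zero fun j hj => Finsupp.single_eq_of_ne' (Finset.ne_of_mem_erase hj)]
    simp
  -- Each `A s` negates the `i`-th coordinate; a kernel vector therefore has `i`-th coordinate zero,
  -- and `A s` fixes such vectors.
  have hAφ : ∀ s v, b.coord i (A s v) = -b.coord i v := by
    intro s v
    simp only [hA, LinearMap.sub_apply, LinearMap.id_apply, LinearMap.smulRight_apply, map_sub,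
      map_smul, hφ, smul_eq_mul]
    ring
  have hAi : ∀ s, Function.Injective (A s) := by
    intro s
    rw [← LinearMap.ker_eq_bot, LinearMap.ker_eq_bot']
    intro v hv
    have h1 := hAφ s v
    rw [hv, map_zero, eq_comm, neg_eq_zero] at h1
    simpa [hA, h1] using hv
  have hdet : (A 0).det = -1 := by
    rw [h0, LinearMap.det_toLin, Matrix.det_diagonal, Finset.prod_ite_mem]
    simp
  intro h
  rw [← h0] at h
  have hswap : A 1 ∘ w = w ∘ Equiv.swap 0 i.succ := by
    have hw0 : w 0 = - ∑ j, b j := by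
      have := hw.sum_eq_zero
      rw [Fin.sum_univ_succ] at this
      simp only [hb, IsCenteredSimplex.basis_apply]
      exact eq_neg_of_add_eq_zero_left this
    have hbi : b i - u 1 = w 0 := by
      rw [hw0, ← Finset.add_sum_erase _ _ (Finset.mem_univ i)]
      simp only [hu, Set.Icc.coe_one, one_smul, two_smul]
      abel
    have hwb : ∀ j, w (Fin.succ j) = b j := fun j => (hw.basis_apply hn j).symm
    funext j
    refine Fin.cases ?_ (fun j => ?_) j
    · have hinv : ∀ v, A 1 (A 1 v) = v := by
        intro v
        have : ∀ v, A 1 v = v - b.coord i v • u 1 := fun v => rfl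
        rw [this (A 1 v), hAφ, this]
        simp
      simp only [Function.comp_apply, Equiv.swap_apply_left]
      rw [hwb, ← hbi]
      have := hAb 1 i
      rw [if_pos rfl] at this
      rw [← this, hinv]
    · simp only [Function.comp_apply, hwb, hAb]
      split_ifs with hj
      · rw [hj, Equiv.swap_apply_right, hbi]
      · rw [Equiv.swap_apply_of_ne_of_ne (Fin.succ_ne_zero _) (by simpa using hj), hwb]
  rw [centeredClass_congr (congrArg (fun L : E →ₗ[ℝ] E => (L ∘ w : Fin (n + 1) → E)) h0.symm),
    centeredClass_eq_of_path (W := fun s => A s ∘ w) _ fun s => hw.map (A s) (hAi s),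
    centeredClass_congr hswap, centeredClass_perm _ hw, ← h0, hdet,
    Equiv.Perm.sign_swap (Fin.succ_ne_zero i).symm]
  · simp
  · intro j
    simp only [hA, hu, Function.comp_apply, LinearMap.sub_apply, LinearMap.smulRight_apply]
    fun_prop

theorem actsBySign_signs (s : Finset (Fin n)) :
    ActsBySign w hw (Matrix.toLin (hw.basis hn) (hw.basis hn)
      (Matrix.diagonal fun j => if j ∈ s then -1 else 1)) := by
  have hdet : ∀ s : Finset (Fin n), (Matrix.diagonal fun j : Fin n =>
      if j ∈ s then (-1 : ℝ) else 1).det ≠ 0 := by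
    intro s
    rw [Matrix.det_diagonal, Finset.prod_ne_zero_iff]
    intro j _
    split_ifs <;> norm_num
  induction s using Finset.induction_on with
  | empty =>
    have : (Matrix.diagonal fun j : Fin n =>
      if j ∈ (∅ : Finset (Fin n)) then (-1 : ℝ) else 1) = 1 := by simp
    rw [this, Matrix.toLin_one]
    exact actsBySign_id
  | insert a s ha ih =>
    have : (Matrix.diagonal fun j : Fin n => if j ∈ insert a s then (-1 : ℝ) else 1) =
        (Matrix.diagonal fun j => if j ∈ ({a} : Finset (Fin n)) then -1 else 1) *
          Matrix.diagonal fun j => if j ∈ s then -1 else 1 := by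
      rw [Matrix.diagonal_mul_diagonal]
      congr 1
      funext j
      by_cases hj : j = a
      · subst hj; simp [ha]
      · simp [hj]
    rw [this, Matrix.toLin_mul _ (hw.basis hn)]
    exact (actsBySign_reflection hn a).comp ih (by rw [LinearMap.det_toLin]; exact hdet _)
      (by rw [LinearMap.det_toLin]; exact hdet _)

/-- Each diagonal entry slides along a segment to its sign without crossing zero. -/
theorem actsBySign_diagonal (D : Fin n → ℝ) (hD : (Matrix.diagonal D).det ≠ 0) :
    ActsBySign w hw (Matrix.toLin (hw.basis hn) (hw.basis hn) (Matrix.diagonal D)) := by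
  have hD0 : ∀ j, D j ≠ 0 := by
    rw [Matrix.det_diagonal, Finset.prod_ne_zero_iff] at hD
    exact fun j => hD j (Finset.mem_univ j)
  set e : Fin n → ℝ := fun j => if j ∈ Finset.univ.filter (fun j => D j < 0) then -1 else 1
    with he
  have hpos : ∀ (s : unitInterval) j, 0 < D j * ((1 - s) * D j + s * e j) := by
    intro s j
    have h1 : 0 < D j ^ 2 := by have := hD0 j; positivity
    have h2 : 0 < D j * e j := by
      rcases lt_or_gt_of_ne (hD0 j) with h | h
      · simp [he, h]
      · simpa [he, h.not_gt] using h
    rcases eq_or_lt_of_le s.2.2 with h | h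
    · rw [h]; simpa using h2
    · nlinarith [mul_pos (sub_pos.2 h) h1, mul_nonneg s.2.1 h2.le]
  have h := actsBySign_toLin_of_path (w := w) (hw := hw) (hw.basis hn)
    (N := fun s => Matrix.diagonal fun j => (1 - s) * D j + s * e j)
    (Continuous.matrix_diagonal (by fun_prop)) (fun s => ?_) ?_ ?_
  · simpa using h
  · rw [Matrix.det_diagonal, Finset.prod_ne_zero_iff]
    exact fun j _ => right_ne_zero_of_mul (hpos s j).ne'
  · have h01 : 0 < (Matrix.diagonal D).det * (Matrix.diagonal e).det := by
      rw [Matrix.det_diagonal, Matrix.det_diagonal, ← Finset.prod_mul_distrib]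
      exact Finset.prod_pos fun j _ => by simpa using hpos 1 j
    simp only [Set.Icc.coe_zero, Set.Icc.coe_one, sub_zero, one_mul, zero_mul, add_zero,
      sub_self, zero_add]
    rcases pos_and_pos_or_neg_and_neg_of_mul_pos h01 with h | h
    · rw [sign_pos h.1, sign_pos h.2]
    · rw [sign_neg h.1, sign_neg h.2]
  · have he1 : (fun j => (1 - ((1 : unitInterval) : ℝ)) * D j + ((1 : unitInterval) : ℝ) * e j) =
        e := by
      funext j
      simp
    rw [he1]
    exact actsBySign_signs hn _

/-- A linear automorphism acts on the fundamental class of `E` at the origin by the sign of its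
determinant. -/
theorem actsBySign_of_det_ne_zero (hn : n = Module.finrank ℝ E) (A : E →ₗ[ℝ] E) (hA : A.det ≠ 0) : ActsBySign w hw A := by
  set b := hw.basis hn with hb
  have hA' : (LinearMap.toMatrix b b A).det ≠ 0 := by rwa [LinearMap.det_toMatrix]
  rw [← Matrix.toLin_toMatrix b b A]
  -- Gaussian elimination: an invertible matrix is a product of transvections and a diagonal matrix.
  -- A transvection contracts to the identity through matrices of determinant one.
  refine Matrix.diagonal_transvection_induction_of_det_ne_zero
    (fun N => ActsBySign w hw (Matrix.toLin b b N)) _ hA' (actsBySign_diagonal hn) ?_ ?_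
  · intro t
    have h := actsBySign_toLin_of_path (w := w) (hw := hw) b
      (N := fun s => Matrix.transvection t.i t.j ((1 - s) * t.c)) ?_ (fun s => ?_) ?_ ?_
    · simpa [Matrix.TransvectionStruct.toMatrix] using h
    · unfold Matrix.transvection
      refine continuous_const.add (continuous_matrix fun i j => ?_)
      simp only [Matrix.single_apply]
      split_ifs <;> fun_prop
    · rw [Matrix.det_transvection_of_ne _ _ t.hij]
      exact one_ne_zero
    · rw [Matrix.det_transvection_of_ne _ _ t.hij, Matrix.det_transvection_of_ne _ _ t.hij]
    · have : Matrix.transvection t.i t.j ((1 - ((1 : unitInterval) : ℝ)) * t.c) = 1 := by simp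
      rw [this, Matrix.toLin_one]
      exact actsBySign_id
  · intro N N' hN hN' h h'
    rw [Matrix.toLin_mul _ b]
    exact h.comp h' (by rwa [LinearMap.det_toLin]) (by rwa [LinearMap.det_toLin])

end LinearAction

/-! ### The index at a nondegenerate fixed point -/

section Nondegenerate

open Filter Topology

variable {E : Type*} [NormedAddCommGroup E] [NormedSpace ℝ E]

/-- Supplies joint continuity at `s = 0` of the rescaling homotopy; the convention `0⁻¹ = 0` gives
the limiting value there. -/
theorem tendsto_inv_smul_of_isLittleO {q : E → E} (hq : q =o[𝓝 0] fun h => h) (v₀ : E) :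
    Tendsto (fun z : ℝ × E => z.1⁻¹ • q (z.1 • z.2)) (𝓝 (0, v₀)) (𝓝 0) := by
  rw [Metric.tendsto_nhds]
  intro ε hε
  have hc : 0 < ε / (‖v₀‖ + 1) := by positivity
  have h1 : Tendsto (fun z : ℝ × E => z.1 • z.2) (𝓝 (0, v₀)) (𝓝 0) := by
    have : Continuous fun z : ℝ × E => z.1 • z.2 := by fun_prop
    simpa using this.tendsto (0, v₀)
  have h2 : ∀ᶠ z : ℝ × E in 𝓝 (0, v₀), ‖z.2‖ < ‖v₀‖ + 1 :=
    (continuous_snd.norm.tendsto ((0 : ℝ), v₀)).eventually_lt_const (lt_add_one _)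
  filter_upwards [h1.eventually (hq.def hc), h2] with z hz hz2
  rw [dist_zero_right, norm_smul, norm_inv]
  rw [norm_smul] at hz
  by_cases h0 : z.1 = 0
  · simpa [h0] using hε
  · have hpos : 0 < ‖z.1‖ := norm_pos_iff.2 h0
    calc ‖z.1‖⁻¹ * ‖q (z.1 • z.2)‖ ≤ ‖z.1‖⁻¹ * (ε / (‖v₀‖ + 1) * (‖z.1‖ * ‖z.2‖)) := by gcongr
      _ = ε / (‖v₀‖ + 1) * ‖z.2‖ := by field_simp
      _ < ε / (‖v₀‖ + 1) * (‖v₀‖ + 1) := by gcongr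
      _ = ε := by field_simp

theorem affineSimplex_eq_add {n : ℕ} (p : E) (w : Fin (n + 1) → E)
    (t : stdSimplex ℝ (Fin (n + 1))) : affineSimplex p w t = p + affineSimplex 0 w t := by
  rw [affineSimplex_zero_apply]
  rfl

/-- An affine simplex with barycenter `p` is star-shaped about `p`. -/
theorem add_smul_affineSimplex_mem {n : ℕ} {V : Set E} {p : E} {w : Fin (n + 1) → E}
    (hw : IsCenteredSimplex w) (hwV : ∀ t, affineSimplex p w t ∈ V)
    (t : stdSimplex ℝ (Fin (n + 1))) (s : unitInterval) :
    p + (s : ℝ) • affineSimplex 0 w t ∈ V := by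
  -- Combining `t` with the barycenter, with weights `s` and `1 - s`, scales the vector by `s`,
  -- because the barycenter contributes zero.
  have hmem := (convex_stdSimplex ℝ (Fin (n + 1))) t.2
    (stdSimplex.barycenter : stdSimplex ℝ (Fin (n + 1))).2 s.2.1 (sub_nonneg.2 s.2.2)
    (add_sub_cancel _ _)
  have h := hwV ⟨_, hmem⟩
  rw [affineSimplex_eq_add] at h
  convert h using 2
  rw [affineSimplex_zero_apply, affineSimplex_zero_apply, Finset.smul_sum]
  have : ∀ j, (⟨_, hmem⟩ : stdSimplex ℝ (Fin (n + 1))) j • w j =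
      (s : ℝ) • t j • w j + ((1 - s : ℝ) * ((n : ℝ) + 1)⁻¹) • w j := by
    intro j
    change ((s : ℝ) * t j + (1 - s) * (stdSimplex.barycenter : stdSimplex ℝ (Fin (n + 1))) j) • w j
      = _
    have hb : (stdSimplex.barycenter : stdSimplex ℝ (Fin (n + 1))) j = ((n : ℝ) + 1)⁻¹ := by
      change (stdSimplex.barycenter : stdSimplex ℝ (Fin (n + 1))).1 j = _
      rw [stdSimplex.barycenter_apply]
      simp
    rw [hb, add_smul, smul_smul]
  rw [Finset.sum_congr rfl fun j _ => this j, Finset.sum_add_distrib, ← Finset.smul_sum,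
    ← Finset.smul_sum, hw.sum_eq_zero, smul_zero, add_zero]

variable {H : Type*} [TopologicalSpace H] {I : ModelWithCorners ℝ E H}
  {X : Type*} [TopologicalSpace X] [ChartedSpace H X]

theorem inChart_self {F : X → X} {p : X} (hp : F p = p) :
    inChart I F p (extChartAt I p p) = extChartAt I p p := by
  rw [inChart, extChartAt_to_inv, hp]

/-- An isolated fixed point is an isolated point of the set of fixed points. -/
theorem IsIsolating.exists_isOpen {F : X → X} {p : X} {V : Set E} (hV : IsIsolating I F p V) :
    ∃ U : Set X, IsOpen U ∧ p ∈ U ∧ ∀ y ∈ U, F y = y → y = p := by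
  refine ⟨(extChartAt I p).source ∩ extChartAt I p ⁻¹' V,
    (continuousOn_extChartAt p).isOpen_inter_preimage (isOpen_extChartAt_source p) hV.isOpen,
    ⟨mem_extChartAt_source p, hV.mem⟩, fun y hy h => ?_⟩
  refine (extChartAt I p).injOn hy.1 (mem_extChartAt_source p) ((hV.fixed_iff _ hy.2).1 ?_)
  rw [inChart, (extChartAt I p).left_inv hy.1, h]

theorem finite_fixedPoints [T2Space X] [CompactSpace X] {F : X → X} (hF : Continuous F)
    (h : ∀ p, F p = p → ∃ V, IsIsolating I F p V) : {p | F p = p}.Finite := by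
  have hcl : IsClosed {p | F p = p} := isClosed_eq hF continuous_id
  refine hcl.isCompact.finite (isDiscrete_iff_discreteTopology.2 ?_)
  rw [discreteTopology_subtype_iff']
  intro p hp
  obtain ⟨V, hV⟩ := h p hp
  obtain ⟨U, hU, hpU, hUp⟩ := hV.exists_isOpen
  exact ⟨U, hU, Set.eq_singleton_iff_unique_mem.2 ⟨⟨hpU, hp⟩, fun y hy => hUp y hy.1 hy.2⟩⟩

variable [FiniteDimensional ℝ E]

/-- An injective linear map in finite dimension is bounded below, so `y - F y` cannot vanish near
`p` except at `p`. -/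
theorem exists_isIsolating [I.Boundaryless] {F : X → X} (hF : Continuous F) {p : X}
    (hp : F p = p) {D : E →L[ℝ] E} (hD : HasFDerivAt (inChart I F p) D (extChartAt I p p))
    (hdet : (ContinuousLinearMap.id ℝ E - D).det ≠ 0) : ∃ V, IsIsolating I F p V := by
  have hB : HasFDerivAt (fun y => y - inChart I F p y) (ContinuousLinearMap.id ℝ E - D)
      (extChartAt I p p) := (hasFDerivAt_id _).sub hD
  have hne := hB.eventually_ne (c := 0) (by
    obtain ⟨C, -, hC⟩ := (ContinuousLinearMap.id ℝ E - D).toLinearMap.exists_antilipschitzWith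
      (LinearMap.ker_eq_bot.2 (injective_of_det_ne_zero hdet))
    exact ⟨C, hC⟩)
  rw [eventually_nhdsWithin_iff, eventually_nhds_iff] at hne
  obtain ⟨U, hU, hUo, hpU⟩ := hne
  have hcont : ContinuousOn (fun y => F ((extChartAt I p).symm y)) (extChartAt I p).target :=
    hF.comp_continuousOn (continuousOn_extChartAt_symm p)
  refine ⟨((extChartAt I p).target ∩
    (fun y => F ((extChartAt I p).symm y)) ⁻¹' (extChartAt I p).source) ∩ U, ?_, ?_, ?_, ?_, ?_, ?_⟩
  · exact (hcont.isOpen_inter_preimage (isOpen_extChartAt_target p)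
      (isOpen_extChartAt_source p)).inter hUo
  · refine ⟨⟨mem_extChartAt_target p, ?_⟩, hpU⟩
    rw [Set.mem_preimage, extChartAt_to_inv, hp]
    exact mem_extChartAt_source p
  · exact fun y hy => hy.1.1
  · exact fun y hy => hy.1.2
  · exact (continuousOn_extChartAt p).comp (hcont.mono fun y hy => hy.1.1) fun y hy => hy.1.2
  · intro y hy
    constructor
    · intro h
      by_contra hyp
      exact hU y hy.2 hyp (by rw [h, sub_self])
    · rintro rfl
      exact inChart_self hp

/-- The homotopy `s⁻¹ • (id - F)(x + s • v)`, for `v` in the centered simplex, extends to `s = 0` by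
the linear part `B v`. Star-shapedness keeps `x + s • v` in `V`; for `v` on the boundary and `s ≠ 0`
this point differs from `x`, so it is not fixed and the value is nonzero. -/
theorem map_pointClass_of_hasFDerivAt {F : X → X} {p : X} (hp : F p = p) {D : E →L[ℝ] E}
    (hD : HasFDerivAt (inChart I F p) D (extChartAt I p p))
    (hdet : (ContinuousLinearMap.id ℝ E - D).det ≠ 0) {V : Set E} (hV : IsIsolating I F p V)
    {w : Fin (Module.finrank ℝ E + 1) → E} (hw : IsCenteredSimplex w)
    (hwV : ∀ t, affineSimplex (extChartAt I p p) w t ∈ V) :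
    RelHomology.map hV.idSub hV.mapsTo_idSub (Module.finrank ℝ E)
        (pointClass V (extChartAt I p p) w hw hwV) =
      (SignType.sign (ContinuousLinearMap.id ℝ E - D).det : ℤ) • originClass w hw := by
  set B := ContinuousLinearMap.id ℝ E - D with hBdef
  set x := extChartAt I p p with hx
  have hBi : Function.Injective B := injective_of_det_ne_zero (A := (B : E →ₗ[ℝ] E)) hdet
  set q : E → E := fun h => (x + h - inChart I F p (x + h)) - B h with hq
  have hqo : q =o[𝓝 0] fun h => h := by
    have hB : HasFDerivAt (fun y => y - inChart I F p y) B x := (hasFDerivAt_id _).sub hD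
    rw [hasFDerivAt_iff_isLittleO_nhds_zero] at hB
    simpa only [hx, inChart_self hp, sub_self, sub_zero] using hB
  have hmem := add_smul_affineSimplex_mem hw hwV
  have hqc : ∀ t (s : unitInterval), ContinuousAt q ((s : ℝ) • affineSimplex 0 w t) := by
    intro t s
    have hc : ContinuousAt (inChart I F p) (x + (s : ℝ) • affineSimplex 0 w t) :=
      hV.continuousOn.continuousAt (hV.isOpen.mem_nhds (hmem t s))
    have hadd : ContinuousAt (fun h => x + h) ((s : ℝ) • affineSimplex 0 w t) := by fun_prop
    exact (hadd.sub (ContinuousAt.comp (f := fun h => x + h) hc hadd)).sub B.continuous.continuousAt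
  have hcont : Continuous fun z : stdSimplex ℝ (Fin (Module.finrank ℝ E + 1)) × unitInterval =>
      B (affineSimplex 0 w z.1) + (z.2 : ℝ)⁻¹ • q ((z.2 : ℝ) • affineSimplex 0 w z.1) := by
    refine (B.continuous.comp ((affineSimplex 0 w).continuous.comp continuous_fst)).add ?_
    have hpair : Continuous fun z : stdSimplex ℝ (Fin (Module.finrank ℝ E + 1)) × unitInterval =>
        ((z.2 : ℝ), affineSimplex 0 w z.1) :=
      (continuous_subtype_val.comp continuous_snd).prodMk
        ((affineSimplex 0 w).continuous.comp continuous_fst)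
    rw [continuous_iff_continuousAt]
    rintro ⟨t, s⟩
    by_cases hs : (s : ℝ) = 0
    · have h := tendsto_inv_smul_of_isLittleO hqo (affineSimplex 0 w t)
      have h' := hpair.tendsto (t, s)
      simp only [hs] at h'
      have h'' := h.comp h'
      simp only [ContinuousAt, hs, inv_zero, zero_smul]
      exact h''
    · refine ContinuousAt.smul ?_ ?_
      · exact ContinuousAt.inv₀ (continuous_subtype_val.comp continuous_snd).continuousAt hs
      · exact ContinuousAt.comp (f := fun z : stdSimplex ℝ (Fin (Module.finrank ℝ E + 1)) ×
          unitInterval => (z.2 : ℝ) • affineSimplex 0 w z.1) (x := (t, s)) (g := q) (hqc t s)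
          (hpair.fst.smul hpair.snd).continuousAt
  have hne : ∀ t : stdSimplex ℝ (Fin (Module.finrank ℝ E + 1)), (∃ i, t i = 0) →
      ∀ s : unitInterval, B (affineSimplex 0 w t) +
        (s : ℝ)⁻¹ • q ((s : ℝ) • affineSimplex 0 w t) ≠ 0 := by
    intro t ht s
    have hv := affineSimplex_ne 0 hw t ht
    by_cases hs : (s : ℝ) = 0
    · simpa [hs] using fun h => hv ((map_eq_zero_iff B hBi).1 h)
    · intro h
      have h1 : (s : ℝ) • (B (affineSimplex 0 w t) +
          (s : ℝ)⁻¹ • q ((s : ℝ) • affineSimplex 0 w t)) = 0 := by rw [h, smul_zero]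
      rw [smul_add, smul_inv_smul₀ hs, ← map_smul, hq, add_sub_cancel, sub_eq_zero, eq_comm,
        hV.fixed_iff _ (hmem t s), add_eq_left, smul_eq_zero] at h1
      exact h1.elim hs hv
  refine (RelHomology.map_ofSimplex _ _ _ _).trans ?_
  refine Eq.trans ?_ (actsBySign_of_det_ne_zero (hw := hw) rfl (B : E →ₗ[ℝ] E) hdet
    (hw.map _ hBi))
  symm
  refine RelHomology.ofSimplex_eq_of_homotopy ⟨_, hcont⟩ (fun t ht s => hne t ht s) ?_ ?_ _ _
  · intro t
    simp [affineSimplex_zero_apply]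
  · intro t
    change B (affineSimplex 0 w t) + ((1 : unitInterval) : ℝ)⁻¹ •
      q (((1 : unitInterval) : ℝ) • affineSimplex 0 w t) =
      affineSimplex x w t - inChart I F p (affineSimplex x w t)
    rw [affineSimplex_eq_add x]
    simp [hq]

/-- The index at a fixed point `p` with `det (1 - D_p F) ≠ 0` is the sign of this determinant. -/
theorem hasFixedPointIndex_of_hasFDerivAt [I.Boundaryless] {F : X → X} (hF : Continuous F) {p : X}
    (hp : F p = p) {D : E →L[ℝ] E} (hD : HasFDerivAt (inChart I F p) D (extChartAt I p p))
    (hdet : (ContinuousLinearMap.id ℝ E - D).det ≠ 0) :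
    HasFixedPointIndex I F p (SignType.sign (ContinuousLinearMap.id ℝ E - D).det : ℤ) :=
  ⟨exists_isIsolating hF hp hD hdet, fun _ hV _ hw hwV =>
    map_pointClass_of_hasFDerivAt hp hD hdet hV hw hwV⟩

end Nondegenerate

/-! ### The determinant of a cyclic operator -/

section CyclicDeterminant

theorem det_id_sub_comp_comm {K V W : Type*} [Field K] [AddCommGroup V] [Module K V]
    [FiniteDimensional K V] [AddCommGroup W] [Module K W] [FiniteDimensional K W]
    (f : V →ₗ[K] W) (g : W →ₗ[K] V) :
    (LinearMap.id - f ∘ₗ g).det = (LinearMap.id - g ∘ₗ f).det := by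
  have b := Module.finBasis K V
  have c := Module.finBasis K W
  rw [← LinearMap.det_toMatrix b, ← LinearMap.det_toMatrix c, map_sub, map_sub,
    LinearMap.toMatrix_id, LinearMap.toMatrix_id, LinearMap.toMatrix_comp c b c,
    LinearMap.toMatrix_comp b c b, Matrix.det_one_sub_mul_comm]

/-- The characteristic polynomial is a power of `X`; evaluate it at `1`. -/
theorem det_id_sub_of_isNilpotent {K V : Type*} [Field K] [AddCommGroup V] [Module K V]
    [FiniteDimensional K V] {S : Module.End K V} (hS : IsNilpotent S) :
    (LinearMap.id - S).det = 1 := by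
  have h := LinearMap.eval_charpoly S 1
  rw [hS.charpoly_eq_X_pow_finrank, map_one] at h
  rw [Polynomial.eval_pow, Polynomial.eval_X, one_pow] at h
  exact h.symm

variable {K E : Type*} [Field K] [AddCommGroup E] [Module K E]

/-- The operator `v ↦ (0, a₀ v₀, a₁ v₁, …)` on `E ^ (n + 1)`. -/
def weightedShift (a : ℕ → E →ₗ[K] E) (n : ℕ) : Module.End K (Fin (n + 1) → E) :=
  LinearMap.pi (Fin.cases 0 fun j => a j ∘ₗ LinearMap.proj j.castSucc)

theorem weightedShift_zero (a : ℕ → E →ₗ[K] E) (n : ℕ) (v : Fin (n + 1) → E) :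
    weightedShift a n v 0 = 0 := rfl

theorem weightedShift_succ (a : ℕ → E →ₗ[K] E) (n : ℕ) (v : Fin (n + 1) → E) (j : Fin n) :
    weightedShift a n v j.succ = a j (v j.castSucc) := rfl

theorem isNilpotent_weightedShift (a : ℕ → E →ₗ[K] E) (n : ℕ) :
    IsNilpotent (weightedShift a n) := by
  have h : ∀ (m : ℕ) (v : Fin (n + 1) → E) (i : Fin (n + 1)), (i : ℕ) < m →
      (weightedShift a n ^ m) v i = 0 := by
    intro m
    induction m with
    | zero => intro v i hi; omega
    | succ m ih =>
      intro v i hi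
      rw [pow_succ', Module.End.mul_apply]
      induction i using Fin.cases with
      | zero => rfl
      | succ j =>
        rw [weightedShift_succ, ih v j.castSucc (by simpa using hi), map_zero]
  exact ⟨n + 1, LinearMap.ext fun v => funext fun i => h _ v i i.2⟩

/-- The operator `v ↦ (a_{l-1} v_{l-1}, a₀ v₀, a₁ v₁, …)` on `E ^ l`. -/
def weightedRotation (a : ℕ → E →ₗ[K] E) (l : ℕ) : Module.End K (Fin l → E) :=
  LinearMap.pi fun j => a ((finRotate l).symm j) ∘ₗ LinearMap.proj ((finRotate l).symm j)

theorem finRotate_symm_zero (n : ℕ) : (finRotate (n + 1)).symm 0 = Fin.last n := by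
  rw [Equiv.symm_apply_eq, finRotate_last]

theorem finRotate_symm_succ {n : ℕ} (j : Fin n) :
    (finRotate (n + 1)).symm j.succ = j.castSucc := by
  rw [Equiv.symm_apply_eq, finRotate_apply, Fin.coeSucc_eq_succ]

/-- With `S` the weighted shift, the recursion for `P` makes `(1 - S) ∘ T` the inclusion of the
first summand, so `1 - R = (1 - S)(1 - TQ)` for the rotation `R`. The first factor has determinant
one, and `det (1 - TQ) = det (1 - QT)` with `QT = a n ∘ P n`. -/
theorem det_id_sub_weightedRotation [FiniteDimensional K E] (a P : ℕ → E →ₗ[K] E)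
    (hP0 : P 0 = LinearMap.id) (hP : ∀ j, P (j + 1) = a j ∘ₗ P j) (l : ℕ) [NeZero l] :
    (LinearMap.id - weightedRotation a l).det = (LinearMap.id - P l).det := by
  obtain ⟨n, rfl⟩ := Nat.exists_eq_succ_of_ne_zero (NeZero.ne l)
  set Q : (Fin (n + 1) → E) →ₗ[K] E := a n ∘ₗ LinearMap.proj (Fin.last n) with hQ
  set T : E →ₗ[K] (Fin (n + 1) → E) := LinearMap.pi fun j => P j with hT
  have hfac : LinearMap.id - weightedRotation a (n + 1) =
      (LinearMap.id - weightedShift a n) ∘ₗ (LinearMap.id - T ∘ₗ Q) := by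
    refine LinearMap.ext fun v => funext fun i => ?_
    simp only [LinearMap.comp_apply, LinearMap.sub_apply, LinearMap.id_apply, Pi.sub_apply,
      map_sub, weightedRotation, LinearMap.pi_apply, LinearMap.proj_apply]
    induction i using Fin.cases with
    | zero =>
      rw [weightedShift_zero, weightedShift_zero, finRotate_symm_zero]
      simp [hT, hQ, hP0]
    | succ j =>
      rw [weightedShift_succ, weightedShift_succ, finRotate_symm_succ]
      simp [hT, hP]
  rw [hfac, LinearMap.det_comp, det_id_sub_of_isNilpotent (isNilpotent_weightedShift a n), one_mul,
    det_id_sub_comp_comm, show P n.succ = a n ∘ₗ P n from hP n]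
  rfl

end CyclicDeterminant

/-! ### Fixed points and fixed point classes of Fuller maps -/

section FullerFixedPoints

variable {M : Type*}

theorem fuller_apply_zero (f : M → M) (n : ℕ) (v : Fin (n + 1) → M) :
    fuller f (n + 1) v 0 = f (v (Fin.last n)) := by
  rw [fuller, finRotate_symm_zero]

theorem fuller_apply_succ (f : M → M) (n : ℕ) (v : Fin (n + 1) → M) (j : Fin n) :
    fuller f (n + 1) v j.succ = f (v j.castSucc) := by
  rw [fuller, finRotate_symm_succ]

theorem fuller_orbitPoint {f : M → M} {l : ℕ} [NeZero l] {x : M} (hx : f^[l] x = x) :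
    fuller f l (orbitPoint f l x) = orbitPoint f l x := by
  obtain ⟨n, rfl⟩ := Nat.exists_eq_succ_of_ne_zero (NeZero.ne l)
  funext j
  induction j using Fin.cases with
  | zero =>
    rw [fuller_apply_zero]
    exact (Function.iterate_succ_apply' f n x).symm.trans hx
  | succ j =>
    rw [fuller_apply_succ]
    exact (Function.iterate_succ_apply' f j x).symm

theorem eq_orbitPoint_of_fuller_eq {f : M → M} {l : ℕ} [NeZero l] {q : Fin l → M}
    (hq : fuller f l q = q) : q = orbitPoint f l (q 0) := by
  obtain ⟨n, rfl⟩ := Nat.exists_eq_succ_of_ne_zero (NeZero.ne l)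
  funext j
  induction j using Fin.induction with
  | zero => rfl
  | succ j ih =>
    rw [← congrFun hq j.succ]
    refine (fuller_apply_succ f n q j).trans ?_
    rw [ih]
    exact (Function.iterate_succ_apply' f j (q 0)).symm

theorem orbitPoint_injective (f : M → M) (l : ℕ) [NeZero l] :
    Function.Injective (orbitPoint f l) :=
  fun _ _ h => congrFun h 0

/-- Rotating indices modulo `k * l` and then reducing modulo `l` is the same as rotating modulo `l`.
-/
theorem fullerFixed_repeat [TopologicalSpace M] (f : M → M) (k l : ℕ) [NeZero k]
    (v : Fin l → M) :
    fullerFixed f k l (repeatHomeomorph k l v) = repeatHomeomorph k l (fuller f l v) := by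
  refine Subtype.ext (funext fun j => ?_)
  change f (v _) = f (v _)
  refine congrArg (fun i => f (v i)) ?_
  rw [eq_comm, Equiv.symm_apply_eq]
  set i := (finRotate (k * l)).symm j with hi
  have hj : j = finRotate (k * l) i := by rw [hi, Equiv.apply_symm_apply]
  have h1 : (finRotate (k * l) i : ℕ) = (i + 1) % (k * l) := by
    simpa using coe_finRotate_pow (k * l) 1 i
  refine Fin.ext ?_
  have h2 := coe_finRotate_pow l 1 i.modNat
  rw [pow_one] at h2
  rw [h2, hj]
  change (finRotate (k * l) i : ℕ) % l = ((i : ℕ) % l + 1) % l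
  rw [h1, Nat.mod_mod_of_dvd _ (Dvd.intro_left k rfl), Nat.mod_add_mod]

variable [TopologicalSpace M]

theorem continuous_fuller {f : M → M} (hf : Continuous f) (l : ℕ) : Continuous (fuller f l) :=
  continuous_pi fun _ => hf.comp (continuous_apply _)

theorem continuous_fullerFixed {f : M → M} (hf : Continuous f) (k l : ℕ) :
    Continuous (fullerFixed f k l) :=
  ((continuous_fuller hf _).comp continuous_subtype_val).subtype_mk _

theorem apply_eq_of_mem_fixedPointClass {X : Type*} [TopologicalSpace X] {F : X → X} {x y : X}
    (h : y ∈ fixedPointClass F x) : F y = y := by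
  obtain ⟨γ, γ', h, -⟩ := h
  simpa using (h 1).symm

/-- The paths are compared pointwise because their endpoints agree with `g a` and `g b` only
propositionally. -/
theorem homotopic_of_eq_map {X Y : Type*} [TopologicalSpace X] [TopologicalSpace Y] {g : X → Y}
    (hg : Continuous g) {a b : X} {γ γ' : Path a b} (h : γ.Homotopic γ') {c d : Y}
    {δ δ' : Path c d} (hδ : ∀ t, δ t = g (γ t)) (hδ' : ∀ t, δ' t = g (γ' t)) :
    δ.Homotopic δ' := by
  obtain rfl : c = g a := by simpa using hδ 0
  obtain rfl : d = g b := by simpa using hδ 1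
  have e : δ = γ.map hg := Path.ext (funext hδ)
  have e' : δ' = γ'.map hg := Path.ext (funext hδ')
  rw [e, e']
  exact h.map ⟨g, hg⟩

/-- A homeomorphism conjugating self-maps identifies their fixed point classes. -/
theorem fixedPointClass_conj {X Y : Type*} [TopologicalSpace X] [TopologicalSpace Y] (e : X ≃ₜ Y)
    {F : X → X} {G : Y → Y} (h : ∀ x, G (e x) = e (F x)) (x : X) :
    fixedPointClass G (e x) = e '' fixedPointClass F x := by
  ext y
  constructor
  · rintro ⟨γ, γ', hγ, hh⟩
    refine ⟨e.symm y, ?_, e.apply_symm_apply y⟩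
    refine ⟨(γ.map e.symm.continuous).cast (e.symm_apply_apply x).symm rfl,
      (γ'.map e.symm.continuous).cast (e.symm_apply_apply x).symm rfl, fun t => ?_,
      homotopic_of_eq_map e.symm.continuous hh (fun _ => rfl) fun _ => rfl⟩
    change e.symm (γ' t) = F (e.symm (γ t))
    rw [hγ, Homeomorph.symm_apply_eq, ← h, Homeomorph.apply_symm_apply]
  · rintro ⟨z, ⟨γ, γ', hγ, hh⟩, rfl⟩
    refine ⟨γ.map e.continuous, γ'.map e.continuous, fun t => ?_, hh.map ⟨e, e.continuous⟩⟩
    change e (γ' t) = G (e (γ t))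
    rw [h, hγ]

/-- Take `Γ = (γ, f γ, …, f^n γ)`. The Fuller map changes only its first coordinate, to `f^[n + 1]
γ`, and there the given homotopy applies. -/
theorem orbitPoint_mem_fixedPointClass {f : M → M} (hf : Continuous f) {l : ℕ} [NeZero l]
    {x y : M} (h : y ∈ fixedPointClass (f^[l]) x) :
    orbitPoint f l y ∈ fixedPointClass (fuller f l) (orbitPoint f l x) := by
  obtain ⟨n, rfl⟩ := Nat.exists_eq_succ_of_ne_zero (NeZero.ne l)
  obtain ⟨γ, γ', hγ, hh⟩ := h
  set Γ : Path (orbitPoint f (n + 1) x) (orbitPoint f (n + 1) y) :=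
    Path.pi fun j : Fin (n + 1) => γ.map (hf.iterate j) with hΓ
  have key : ∀ j : Fin (n + 1), ∃ δ : Path (orbitPoint f (n + 1) x j) (orbitPoint f (n + 1) y j),
      (∀ t, δ t = fuller f (n + 1) (Γ t) j) ∧ Path.Homotopic (γ.map (hf.iterate j)) δ := by
    intro j
    induction j using Fin.cases with
    | zero =>
      refine ⟨γ', fun t => ?_, hh⟩
      rw [fuller_apply_zero]
      exact (hγ t).trans (Function.iterate_succ_apply' f n (γ t))
    | succ j =>
      refine ⟨γ.map (hf.iterate j.succ), fun t => ?_, Path.Homotopic.refl _⟩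
      rw [fuller_apply_succ]
      exact Function.iterate_succ_apply' f j (γ t)
  choose δ hδ hδh using key
  exact ⟨Γ, Path.pi δ, fun t => funext fun j => hδ j t,
    ⟨Path.Homotopic.piHomotopy _ _ fun j => (hδh j).some⟩⟩

/-- A homotopy from `Γ` to its Fuller image says `Γ_{j+1} ∼ f Γ_j` and `Γ_0 ∼ f Γ_n`. Chaining these
gives `Γ_0 ∼ f^[n + 1] Γ_0`. -/
theorem mem_fixedPointClass_of_fuller {f : M → M} (hf : Continuous f) {l : ℕ} [NeZero l]
    {x : M} {q : Fin l → M} (h : q ∈ fixedPointClass (fuller f l) (orbitPoint f l x)) :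
    q 0 ∈ fixedPointClass (f^[l]) x := by
  have hq := eq_orbitPoint_of_fuller_eq (apply_eq_of_mem_fixedPointClass h)
  obtain ⟨n, rfl⟩ := Nat.exists_eq_succ_of_ne_zero (NeZero.ne l)
  obtain ⟨Γ, Γ', hΓ, hh⟩ := h
  have hcoord : ∀ j : Fin (n + 1), Path.Homotopic (Γ.map (continuous_apply j))
      (Γ'.map (continuous_apply j)) := fun j => hh.map ⟨_, continuous_apply j⟩
  set γ₀ : Path x (q 0) := Γ.map (continuous_apply (0 : Fin (n + 1))) with hγ₀
  have hpath : ∀ j : Fin (n + 1), ∃ δ : Path (orbitPoint f (n + 1) x j) (q j),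
      ∀ t, δ t = f^[j] (γ₀ t) := fun j =>
    ⟨(γ₀.map (hf.iterate j)).cast rfl (congrFun hq j), fun t => rfl⟩
  have key : ∀ (j : Fin (n + 1)) (δ : Path (orbitPoint f (n + 1) x j) (q j)),
      (∀ t, δ t = f^[j] (γ₀ t)) → Path.Homotopic (Γ.map (continuous_apply j)) δ := by
    intro j
    induction j using Fin.induction with
    | zero =>
      intro δ hδ
      rw [show δ = Γ.map (continuous_apply (0 : Fin (n + 1))) from Path.ext (funext hδ)]
    | succ j ih =>
      intro δ hδ
      obtain ⟨ε, hε⟩ := hpath j.castSucc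
      refine (hcoord j.succ).trans (homotopic_of_eq_map hf (ih ε hε) (fun t => ?_) fun t => ?_)
      · exact (congrFun (hΓ t) j.succ).trans (fuller_apply_succ f n _ j)
      · rw [hδ, hε]
        exact Function.iterate_succ_apply' f j (γ₀ t)
  obtain ⟨ε, hε⟩ := hpath (Fin.last n)
  have hlast : ∀ t, Γ' t 0 = f (Γ t (Fin.last n)) := fun t =>
    (congrFun (hΓ t) 0).trans (fuller_apply_zero f n _)
  have hfε : ∀ t, f^[n + 1] (γ₀ t) = f (ε t) := fun t => by
    rw [hε]
    exact Function.iterate_succ_apply' f n (γ₀ t)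
  have hsrc : x = f^[n + 1] x := by
    have h1 := hfε 0
    have h2 := hlast 0
    simp only [Path.source] at h1 h2
    rw [h1]
    exact h2
  have htgt : q 0 = f^[n + 1] (q 0) := by
    have h1 := hfε 1
    have h2 := hlast 1
    simp only [Path.target] at h1 h2
    rw [h1]
    exact h2
  exact ⟨γ₀, (γ₀.map (hf.iterate (n + 1))).cast hsrc htgt, fun t => rfl,
    (hcoord 0).trans (homotopic_of_eq_map hf (key _ ε hε) hlast hfε)⟩

theorem fixedPointClass_fuller {f : M → M} (hf : Continuous f) (l : ℕ) [NeZero l] (x : M) :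
    fixedPointClass (fuller f l) (orbitPoint f l x) =
      orbitPoint f l '' fixedPointClass (f^[l]) x := by
  ext q
  constructor
  · exact fun h => ⟨q 0, mem_fixedPointClass_of_fuller hf h,
      (eq_orbitPoint_of_fuller_eq (apply_eq_of_mem_fixedPointClass h)).symm⟩
  · rintro ⟨y, hy, rfl⟩
    exact orbitPoint_mem_fixedPointClass hf hy

end FullerFixedPoints

/-! ### Indices of Fuller maps -/

section FullerIndex

variable {E : Type*} [NormedAddCommGroup E] [NormedSpace ℝ E]
  {H : Type*} [TopologicalSpace H] {I : ModelWithCorners ℝ E H}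
  {M : Type*} [TopologicalSpace M] [ChartedSpace H M]

theorem mdifferentiable_iterate {f : M → M} (hf : MDifferentiable I I f) (j : ℕ) :
    MDifferentiable I I (f^[j]) := by
  induction j with
  | zero => exact mdifferentiable_id
  | succ j ih =>
    rw [Function.iterate_succ']
    exact hf.comp ih

/-- Transfer of class indices along an injection of fixed point classes. -/
theorem HasClassIndex.of_image {E' : Type*} [NormedAddCommGroup E'] [NormedSpace ℝ E']
    {H' : Type*} [TopologicalSpace H'] {I' : ModelWithCorners ℝ E' H'} {Z Y : Type*}
    [TopologicalSpace Y] [ChartedSpace H' Y] {G : Y → Y} {y : Y} {g : Z → Y}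
    (hg : Function.Injective g) {s : Finset Z} {j : Z → ℤ} {i : ℤ}
    (hs : fixedPointClass G y = g '' s) (hj : ∀ z ∈ s, HasFixedPointIndex I' G (g z) (j z))
    (hi : ∑ z ∈ s, j z = i) : HasClassIndex I' G y i := by
  classical
  refine ⟨s.image g, Function.extend g j 0, by rw [hs, Finset.coe_image], ?_, ?_⟩
  · intro z hz
    obtain ⟨u, hu, rfl⟩ := Finset.mem_image.1 hz
    rw [hg.extend_apply]
    exact hj u hu
  · rw [Finset.sum_image hg.injOn, ← hi]
    exact Finset.sum_congr rfl fun z _ => hg.extend_apply _ _ _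

/-- The differential of the Fuller map at a periodic orbit. -/
def fullerDeriv (I : ModelWithCorners ℝ E H) (f : M → M) (l : ℕ) (x : M) :
    (Fin l → E) →L[ℝ] (Fin l → E) :=
  ContinuousLinearMap.pi fun j =>
    tangentEnd I f (f^[((finRotate l).symm j : ℕ)] x) ∘L
      ContinuousLinearMap.proj ((finRotate l).symm j)

/-- The blocks are the differentials of `f` at `f^j x`, the partial products those of `f^j` at `x`;
the chain rule is the required recursion. -/
theorem det_id_sub_fullerDeriv [FiniteDimensional ℝ E] {f : M → M} (hf : MDifferentiable I I f)
    (l : ℕ) [NeZero l] (x : M) :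
    (ContinuousLinearMap.id ℝ (Fin l → E) - fullerDeriv I f l x).det =
      (ContinuousLinearMap.id ℝ E - tangentEnd I (f^[l]) x).det := by
  refine det_id_sub_weightedRotation (K := ℝ) (E := E)
    (fun j => (tangentEnd I f (f^[j] x) : E →ₗ[ℝ] E))
    (fun j => (tangentEnd I (f^[j]) x : E →ₗ[ℝ] E)) ?_ (fun j => ?_) l
  · refine LinearMap.ext fun v => ?_
    change mfderiv I I id x v = v
    rw [mfderiv_id]
    rfl
  · refine LinearMap.ext fun v => ?_
    change mfderiv I I (f^[j + 1]) x v = mfderiv I I f (f^[j] x) (mfderiv I I (f^[j]) x v)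
    rw [Function.iterate_succ', mfderiv_comp x (hf _) (mdifferentiable_iterate hf j x)]
    rfl

variable [I.Boundaryless]

instance pi_boundaryless (l : ℕ) : (ModelWithCorners.pi fun _ : Fin l => I).Boundaryless where
  range_eq_univ := by
    refine Set.range_eq_univ.2 fun y => ⟨fun j => I.symm (y j), funext fun j => ?_⟩
    exact I.right_inv (by rw [I.range_eq_univ]; exact Set.mem_univ _)

theorem hasFDerivAt_writtenInExtChartAt {f : M → M} {p : M} (hf : MDifferentiableAt I I f p) :
    HasFDerivAt (writtenInExtChartAt I I p f) (tangentEnd I f p)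
      (extChartAt I p p) := by
  have h : HasFDerivWithinAt (writtenInExtChartAt I I p f) (tangentEnd I f p) (Set.range I)
    (extChartAt I p p) := hf.hasMFDerivAt.2
  rwa [I.range_eq_univ, hasFDerivWithinAt_univ] at h

theorem hasFDerivAt_inChart {F : M → M} {p : M} (hF : MDifferentiableAt I I F p) (hp : F p = p) :
    HasFDerivAt (inChart I F p) (tangentEnd I F p) (extChartAt I p p) := by
  have h := hasFDerivAt_writtenInExtChartAt hF
  unfold writtenInExtChartAt at h
  rw [hp] at h
  exact h

/-- Coordinate `j` reads `f` from the chart at the preceding orbit point into the chart at its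
image, which is orbit point `j` because the orbit closes up. -/
theorem hasFDerivAt_inChart_fuller {f : M → M} (hf : MDifferentiable I I f) {l : ℕ} [NeZero l]
    {x : M} (hx : f^[l] x = x) :
    HasFDerivAt (inChart (ModelWithCorners.pi fun _ : Fin l => I) (fuller f l) (orbitPoint f l x))
      (fullerDeriv I f l x)
      (extChartAt (ModelWithCorners.pi fun _ : Fin l => I) (orbitPoint f l x)
        (orbitPoint f l x)) := by
  refine hasFDerivAt_pi.2 fun j => ?_
  set i := (finRotate l).symm j with hi
  have hji : orbitPoint f l x j = f (orbitPoint f l x i) :=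
    (congrFun (fuller_orbitPoint hx) j).symm
  have h := hasFDerivAt_writtenInExtChartAt (hf (orbitPoint f l x i))
  unfold writtenInExtChartAt at h
  rw [← hji] at h
  exact HasFDerivAt.comp (f := fun y : Fin l → E => y i)
    (extChartAt (ModelWithCorners.pi fun _ : Fin l => I) (orbitPoint f l x) (orbitPoint f l x)) h
    (ContinuousLinearMap.proj (R := ℝ) (φ := fun _ : Fin l => E) i).hasFDerivAt

theorem inChart_fullerFixed (I : ModelWithCorners ℝ E H) (f : M → M) (k l : ℕ) [NeZero k]
    (q : FixedSet M k l) :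
    inChart (ModelWithCorners.pi fun _ : Fin l => I) (fullerFixed f k l) q =
      inChart (ModelWithCorners.pi fun _ : Fin l => I) (fuller f l)
        ((repeatHomeomorph k l).symm q) := by
  funext y
  change extChartAt (ModelWithCorners.pi fun _ : Fin l => I) ((repeatHomeomorph k l).symm q)
    ((repeatHomeomorph k l).symm (fullerFixed f k l (repeatHomeomorph k l
      ((extChartAt (ModelWithCorners.pi fun _ : Fin l => I)
        ((repeatHomeomorph k l).symm q)).symm y)))) = _
  rw [fullerFixed_repeat, Homeomorph.symm_apply_apply]
  rfl

theorem extChartAt_fixedSet (I : ModelWithCorners ℝ E H) (k l : ℕ) [NeZero k]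
    (q : FixedSet M k l) :
    extChartAt (ModelWithCorners.pi fun _ : Fin l => I) q q =
      extChartAt (ModelWithCorners.pi fun _ : Fin l => I) ((repeatHomeomorph k l).symm q)
        ((repeatHomeomorph k l).symm q) := rfl

variable [FiniteDimensional ℝ E] {f : M → M} {l : ℕ} {x : M}

theorem hasFixedPointIndex_iterate (hf : Continuous f) (hfd : MDifferentiable I I f)
    (hgen : HasOnlyGenericFixedPoints I (f^[l])) (hx : f^[l] x = x) :
    HasFixedPointIndex I (f^[l]) x
      (SignType.sign (ContinuousLinearMap.id ℝ E - tangentEnd I (f^[l]) x).det : ℤ) :=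
  hasFixedPointIndex_of_hasFDerivAt (hf.iterate l) hx
    (hasFDerivAt_inChart (mdifferentiable_iterate hfd l x) hx) (hgen x hx)

variable [NeZero l]

theorem hasFixedPointIndex_fuller (hf : Continuous f) (hfd : MDifferentiable I I f)
    (hgen : HasOnlyGenericFixedPoints I (f^[l])) (hx : f^[l] x = x) :
    HasFixedPointIndex (ModelWithCorners.pi fun _ : Fin l => I) (fuller f l) (orbitPoint f l x)
      (SignType.sign (ContinuousLinearMap.id ℝ E - tangentEnd I (f^[l]) x).det : ℤ) := by
  rw [← det_id_sub_fullerDeriv hfd l x]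
  refine hasFixedPointIndex_of_hasFDerivAt (continuous_fuller hf l) (fuller_orbitPoint hx)
    (hasFDerivAt_inChart_fuller hfd hx) ?_
  rw [det_id_sub_fullerDeriv hfd l x]
  exact hgen x hx

theorem hasFixedPointIndex_fullerFixed (hf : Continuous f) (hfd : MDifferentiable I I f)
    (hgen : HasOnlyGenericFixedPoints I (f^[l])) (hx : f^[l] x = x) (k : ℕ) [NeZero k] :
    HasFixedPointIndex (ModelWithCorners.pi fun _ : Fin l => I) (fullerFixed f k l)
      (repeatHomeomorph k l (orbitPoint f l x))
      (SignType.sign (ContinuousLinearMap.id ℝ E - tangentEnd I (f^[l]) x).det : ℤ) := by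
  rw [← det_id_sub_fullerDeriv hfd l x]
  refine hasFixedPointIndex_of_hasFDerivAt (continuous_fullerFixed hf k l) ?_ ?_ ?_
  · rw [fullerFixed_repeat, fuller_orbitPoint hx]
  · rw [inChart_fullerFixed, extChartAt_fixedSet, Homeomorph.symm_apply_apply]
    exact hasFDerivAt_inChart_fuller hfd hx
  · rw [det_id_sub_fullerDeriv hfd l x]
    exact hgen x hx

end FullerIndex

end FixedPointIndex

end

/-! ### Equality of the point indices and of the class indices -/

theorem proposition5p8 {m : ℕ} {M : Type*} [TopologicalSpace M] [T2Space M] [CompactSpace M]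
    [ChartedSpace (EuclideanSpace ℝ (Fin m)) M] [IsManifold (𝓡 m) ∞ M]
    (f : M → M) (hf : ContMDiff (𝓡 m) (𝓡 m) 1 f)
    (k l : ℕ) [NeZero k] [NeZero l]
    (hgen : FixedPointIndex.HasOnlyGenericFixedPoints (𝓡 m) (f^[l]))
    (x : M) (hx : f^[l] x = x) :
    (∃ i : ℤ,
      FixedPointIndex.HasFixedPointIndex (𝓡 m) (f^[l]) x i ∧
      FixedPointIndex.HasFixedPointIndex (ModelWithCorners.pi fun _ : Fin l => 𝓡 m)
        (FixedPointIndex.fuller f l) (FixedPointIndex.orbitPoint f l x) i ∧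
      FixedPointIndex.HasFixedPointIndex (ModelWithCorners.pi fun _ : Fin l => 𝓡 m)
        (FixedPointIndex.fullerFixed f k l)
        (FixedPointIndex.repeatHomeomorph k l (FixedPointIndex.orbitPoint f l x)) i) ∧
    (∃ i : ℤ,
      FixedPointIndex.HasClassIndex (𝓡 m) (f^[l]) x i ∧
      FixedPointIndex.HasClassIndex (ModelWithCorners.pi fun _ : Fin l => 𝓡 m)
        (FixedPointIndex.fuller f l) (FixedPointIndex.orbitPoint f l x) i ∧
      FixedPointIndex.HasClassIndex (ModelWithCorners.pi fun _ : Fin l => 𝓡 m)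
        (FixedPointIndex.fullerFixed f k l)
        (FixedPointIndex.repeatHomeomorph k l (FixedPointIndex.orbitPoint f l x)) i) := by
  have hc : Continuous f := hf.continuous
  have hd : MDifferentiable (𝓡 m) (𝓡 m) f := hf.mdifferentiable one_ne_zero
  refine ⟨⟨_, FixedPointIndex.hasFixedPointIndex_iterate hc hd hgen hx,
    FixedPointIndex.hasFixedPointIndex_fuller hc hd hgen hx,
    FixedPointIndex.hasFixedPointIndex_fullerFixed hc hd hgen hx k⟩, ?_⟩
  have hfin : (FixedPointIndex.fixedPointClass (f^[l]) x).Finite :=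
    (FixedPointIndex.finite_fixedPoints (I := 𝓡 m) (hc.iterate l) fun p hp =>
      (FixedPointIndex.hasFixedPointIndex_iterate hc hd hgen hp).1).subset
      fun y hy => FixedPointIndex.apply_eq_of_mem_fixedPointClass hy
  have hfix : ∀ y ∈ hfin.toFinset, f^[l] y = y := fun y hy =>
    FixedPointIndex.apply_eq_of_mem_fixedPointClass (hfin.mem_toFinset.1 hy)
  -- The class of `x` indexes all three sums, each term being the sign of `det (1 - D_y f^l)`; the
  -- sums are then identical.
  refine ⟨_, ⟨hfin.toFinset, _, hfin.coe_toFinset, fun y hy =>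
      FixedPointIndex.hasFixedPointIndex_iterate hc hd hgen (hfix y hy), rfl⟩,
    .of_image (FixedPointIndex.orbitPoint_injective f l) ?_
      (fun y hy => FixedPointIndex.hasFixedPointIndex_fuller hc hd hgen (hfix y hy)) rfl,
    .of_image (g := FixedPointIndex.repeatHomeomorph k l ∘ FixedPointIndex.orbitPoint f l)
      ((FixedPointIndex.repeatHomeomorph k l).injective.comp
        (FixedPointIndex.orbitPoint_injective f l)) ?_
      (fun y hy => FixedPointIndex.hasFixedPointIndex_fullerFixed hc hd hgen (hfix y hy) k) rfl⟩
  · rw [FixedPointIndex.fixedPointClass_fuller hc, hfin.coe_toFinset]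
  · rw [FixedPointIndex.fixedPointClass_conj _ (FixedPointIndex.fullerFixed_repeat f k l),
      FixedPointIndex.fixedPointClass_fuller hc, hfin.coe_toFinset, Set.image_comp]
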